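/- Let $K$ be a field of characteristic $0$, let $G$ be a reductive affine algebraic group over $K$ (given by its group of $K$-points with its finitely generated algebra of regular functions; reductive means that every finite dimensional rational representation is completely reducible), and let $V$ be a finite dimensional rational representation of $G$. Let $P$ be a homogeneous polynomial functor of degree $k\ge 0$, that is, a functor from finite dimensional $K$-vector spaces to finite dimensional $K$-vector spaces such that for all $U,W$ the map $\mathrm{Hom}(U,W)\to\mathrm{Hom}(P(U),P(W))$, $f\mapsto P(f)$, is homogeneous polynomial of degree $k$. Then $G$ acts on $P(V)$ by functoriality. Let $\Lambda$ be the ring of symmetric functions over $K$ (symmetric formal power series of bounded degree in $x_1,x_2,\dots$), with complete homogeneous symmetric functions $h_r$, power sums $p_n$, the scalar product with $\langle p_\lambda,p_\mu\rangle=z_\lambda\delta_{\lambda\mu}$, where $z_\lambda=\prod_n n^{m_n}m_n!$ for $\lambda$ with $m_n$ parts equal to $n$, and plethysm $f[g]$, for which $f\mapsto f[g]$ is the $K$-algebra homomorphism with $p_n[g]=g(x_1^n,x_2^n,\dots)$. For $n\ge 0$ let $$I_n(V)=\frac1{n!}\sum_{\pi\in\mathfrak S_n}\mathrm{Tr}\big(\pi\,|\,(V^{\otimes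 n})^G\big)\,p_{\lambda(\pi)}\in\Lambda$$ be the Frobenius character of the $\mathfrak S_n$-representation $(V^{\otimes n})^G$, where $\mathfrak S_n$ permutes the tensor factors and $\lambda(\pi)$ is the cycle type of $\pi$. Then there is a unique symmetric function $\mathrm{ch}\,P\in\Lambda$ (the character of $P$) such that $\mathrm{ch}\,P(a_1,\dots,a_n,0,0,\dots)=\mathrm{Tr}\,P(A)$ for every $n$ and every invertible diagonal matrix $A=\mathrm{diag}(a_1,\dots,a_n)$. For every $r\ge 0$ the space $K[P(V)]^G_r$ of $G$-invariant homogeneous polynomials of degree $r$ on $P(V)$ is finite dimensional, and $$\dim K[P(V)]^G_r=\big\langle h_r[\mathrm{ch}\,P],\,I_{rk}(V)\big\rangle .$$ Consequently the Hilbert series of the graded ring $K[P(V)]^G$ of $G$-invariant polynomials on $P(V)$ is $$\sum_{r\ge 0}\dim K[P(V)]^G_r\,t^r=\sum_{r\ge 0}\big\langle h_r[\mathrm{ch}\,P],\,I_{rk}(V)\big\rangle\,t^r .$$ -/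

import Mathlib

open CategoryTheory

universe u v

noncomputable section

namespace TensorInvariants

/-! ### Symmetric functions -/

/-- The ring `Λ` of symmetric functions with coefficients in `K`: the formal power series of bounded
degree in the variables `x₀, x₁, x₂, …` which are invariant under all permutations of the
variables. -/
def SymFun (K : Type u) [Field K] : Subalgebra K (MvPowerSeries ℕ K) where
  carrier := {f | (∀ e : Equiv.Perm ℕ, MvPowerSeries.rename e f = f) ∧
    ∃ N : ℕ, ∀ d : ℕ →₀ ℕ, N < d.degree → MvPowerSeries.coeff d f = 0}
  mul_mem' := by
    rintro f g ⟨hf, N, hN⟩ ⟨hg, M, hM⟩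
    refine ⟨fun e => by rw [map_mul, hf, hg], N + M, fun d hd => ?_⟩
    classical
    rw [MvPowerSeries.coeff_mul]
    refine Finset.sum_eq_zero fun p hp => ?_
    rw [Finset.HasAntidiagonal.mem_antidiagonal] at hp
    have h : p.1.degree + p.2.degree = d.degree := by rw [← hp, map_add]
    rcases lt_or_ge N p.1.degree with h1 | h1
    · rw [hN _ h1, zero_mul]
    · rw [hM _ (by omega), mul_zero]
  add_mem' := by
    rintro f g ⟨hf, N, hN⟩ ⟨hg, M, hM⟩
    refine ⟨fun e => by rw [map_add, hf, hg], max N M, fun d hd => ?_⟩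
    rw [map_add, hN _ (lt_of_le_of_lt (le_max_left _ _) hd),
      hM _ (lt_of_le_of_lt (le_max_right _ _) hd), add_zero]
  algebraMap_mem' c := by
    refine ⟨fun e => AlgHom.commutes _ c, 0, fun d hd => ?_⟩
    classical
    have hd0 : d ≠ 0 := by
      rintro rfl
      simp at hd
    rw [MvPowerSeries.algebraMap_apply, MvPowerSeries.coeff_C, if_neg hd0]

variable {K : Type u} [Field K]

/-- A power series whose coefficients are invariant under permutations of the variables is fixed by
all renamings of the variables. -/
theorem rename_eq_self {f : MvPowerSeries ℕ K}
    (h : ∀ (e : Equiv.Perm ℕ) (d : ℕ →₀ ℕ), MvPowerSeries.coeff (d.embDomain e.toEmbedding) f =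
      MvPowerSeries.coeff d f) (e : Equiv.Perm ℕ) : MvPowerSeries.rename e f = f := by
  ext d
  obtain ⟨d, rfl⟩ : ∃ d' : ℕ →₀ ℕ, d'.embDomain e.toEmbedding = d :=
    ⟨d.embDomain e.symm.toEmbedding, by
      ext i
      obtain ⟨j, rfl⟩ := e.surjective i
      have h1 := Finsupp.embDomain_apply_self e.toEmbedding (d.embDomain e.symm.toEmbedding) j
      have h2 := Finsupp.embDomain_apply_self e.symm.toEmbedding d (e j)
      simp only [Equiv.coe_toEmbedding, Equiv.symm_apply_apply] at h1 h2
      rw [h1, h2]⟩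
  exact (MvPowerSeries.coeff_embDomain_rename e.toEmbedding f d).trans (h e d).symm

/-- The degree of a monomial does not change when its variables are permuted. -/
theorem degree_embDomain (e : Equiv.Perm ℕ) (d : ℕ →₀ ℕ) :
    (d.embDomain e.toEmbedding).degree = d.degree := by
  rw [Finsupp.degree_apply, Finsupp.degree_apply, Finsupp.support_embDomain, Finset.sum_map]
  exact Finset.sum_congr rfl fun i _ => Finsupp.embDomain_apply_self _ _ _

open Classical in
/-- The complete homogeneous symmetric function `h_r`, the sum of all monomials of degree `r`. -/
def completeHomogeneous (K : Type u) [Field K] (r : ℕ) : SymFun K :=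
  ⟨fun d => if d.degree = r then 1 else 0, by
    refine ⟨rename_eq_self fun e d => ?_, r, fun d hd => if_neg hd.ne'⟩
    change (if _ then _ else _ : K) = if _ then _ else _
    rw [degree_embDomain]⟩

open Classical in
/-- The power sum symmetric function `p_n = ∑ᵢ xᵢⁿ`, for `n ≥ 1`. -/
def powerSum (K : Type u) [Field K] (n : ℕ+) : SymFun K :=
  ⟨fun d => if ∃ i, d = Finsupp.single i (n : ℕ) then 1 else 0, by
    refine ⟨rename_eq_self fun e d => ?_, n, fun d hd => if_neg ?_⟩
    · change (if _ then _ else _ : K) = if _ then _ else _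
      congr 1
      refine propext ⟨?_, ?_⟩
      · rintro ⟨i, hi⟩
        refine ⟨e.symm i, Finsupp.embDomain_injective e.toEmbedding ?_⟩
        rw [hi, Finsupp.embDomain_single]
        simp
      · rintro ⟨i, rfl⟩
        exact ⟨e i, by rw [Finsupp.embDomain_single]; rfl⟩
    · rintro ⟨i, rfl⟩
      simp at hd⟩

/-- The substitution `g ↦ g(x₀ⁿ, x₁ⁿ, …)`, that is `g ↦ p_n[g]`. -/
def powerSubst (n : ℕ+) (g : SymFun K) : SymFun K :=
  ⟨MvPowerSeries.expand n n.ne_zero (g : MvPowerSeries ℕ K), by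
    obtain ⟨g, hg, N, hN⟩ := g
    have key : ∀ d : ℕ →₀ ℕ, (∃ m : ℕ →₀ ℕ, d = (n : ℕ) • m) ∨ ∃ i, ¬ (n : ℕ) ∣ d i := by
      intro d
      by_cases h : ∃ i, ¬ (n : ℕ) ∣ d i
      · exact Or.inr h
      · push Not at h
        refine Or.inl ⟨d.mapRange (fun k => k / (n : ℕ)) (Nat.zero_div _), ?_⟩
        ext i
        simp [Nat.mul_div_cancel' (h i)]
    refine ⟨rename_eq_self fun e d => ?_, n * N, fun d hd => ?_⟩
    · rcases key d with ⟨m, rfl⟩ | ⟨i, hi⟩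
      · have h1 : ((n : ℕ) • m).embDomain e.toEmbedding =
            (n : ℕ) • m.embDomain e.toEmbedding := by
          ext i
          obtain ⟨j, rfl⟩ := e.surjective i
          have h1 := Finsupp.embDomain_apply_self e.toEmbedding ((n : ℕ) • m) j
          have h2 := Finsupp.embDomain_apply_self e.toEmbedding m j
          simp only [Equiv.coe_toEmbedding] at h1 h2
          rw [h1, Finsupp.smul_apply, Finsupp.smul_apply, h2]
        rw [h1, MvPowerSeries.coeff_expand_smul, MvPowerSeries.coeff_expand_smul]
        have h3 := MvPowerSeries.coeff_embDomain_rename e.toEmbedding g m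
        have h4 : MvPowerSeries.rename e.toEmbedding g = g := hg e
        rw [h4] at h3
        exact h3
      · rw [MvPowerSeries.coeff_expand_of_not_dvd _ _ _ hi,
          MvPowerSeries.coeff_expand_of_not_dvd _ _ _ (i := e i)]
        have h1 := Finsupp.embDomain_apply_self e.toEmbedding d i
        simp only [Equiv.coe_toEmbedding] at h1
        rwa [h1]
    · rcases key d with ⟨m, rfl⟩ | ⟨i, hi⟩
      · rw [MvPowerSeries.coeff_expand_smul]
        refine hN _ ?_
        rw [map_nsmul, smul_eq_mul] at hd
        exact lt_of_mul_lt_mul_left hd (Nat.zero_le _)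
      · exact MvPowerSeries.coeff_expand_of_not_dvd _ _ _ hi⟩

/-- The expression of a symmetric function as a polynomial in the power sums `p_1, p_2, …`; the
variable `X n` stands for `p_n`. (Over a field of characteristic zero each symmetric function has
exactly one such expression.) -/
def powerSumExpansion (f : SymFun K) : MvPolynomial ℕ+ K :=
  Function.invFun (MvPolynomial.aeval (powerSum K)) f

/-- Plethysm `f[g]`: the map `f ↦ f[g]` is the homomorphism of `K`-algebras with
`p_n[g] = g(x₀ⁿ, x₁ⁿ, …)`. -/
def plethysm (f g : SymFun K) : SymFun K :=
  MvPolynomial.aeval (fun n : ℕ+ => powerSubst n g) (powerSumExpansion f)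

/-- `z_λ = ∏ₙ n^{mₙ} mₙ!` for the partition `λ` with `mₙ` parts equal to `n`. -/
def zCoeff (m : ℕ+ →₀ ℕ) : ℕ :=
  m.prod fun n k => (n : ℕ) ^ k * k.factorial

/-- The (Hall) scalar product of symmetric functions: the bilinear form for which
`⟨p_λ, p_μ⟩ = z_λ` if `λ = μ`, and `= 0` otherwise. -/
def hallInner (f g : SymFun K) : K :=
  ∑ m ∈ (powerSumExpansion f).support,
    (zCoeff m : K) * (powerSumExpansion f).coeff m * (powerSumExpansion g).coeff m

/-- The value `f(a₁, …, aₙ, 0, 0, …)` of a symmetric function. The sum is finite, because `f` has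
bounded degree. -/
def evalFin (f : SymFun K) {n : ℕ} (a : Fin n → K) : K :=
  ∑ᶠ d : Fin n →₀ ℕ, MvPowerSeries.coeff (d.embDomain Fin.valEmbedding) (f : MvPowerSeries ℕ K) *
    ∏ i, a i ^ d i

/-- The power sum `p_{λ(π)}` of the cycle type of a permutation, fixed points being cycles of
length one. -/
def cyclePowerSum (K : Type u) [Field K] {n : ℕ} (π : Equiv.Perm (Fin n)) : SymFun K :=
  (π.partition.parts.attach.map fun i =>
    powerSum K ⟨i.1, π.partition.parts_pos i.2⟩).prod

/-- The Frobenius character `(1/n!) ∑_π Tr(τ π) p_{λ(π)}` of a representation of the symmetric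
group. -/
def frobeniusCharacter {n : ℕ} {A : Type*} [AddCommGroup A] [Module K A]
    (τ : Representation K (Equiv.Perm (Fin n)) A) : SymFun K :=
  ((n.factorial : K)⁻¹) • ∑ π : Equiv.Perm (Fin n), LinearMap.trace K A (τ π) • cyclePowerSum K π

/-! ### Affine algebraic groups and their rational representations -/

/-- The structure of an affine algebraic group over `K` on a group `G` (the group of `K`-points):
a finitely generated algebra of functions, the regular functions, such that the points of `G` are
the `K`-algebra homomorphisms from it to `K`, and such that multiplication `G × G → G` and inversion
`G → G` are morphisms, that is, pull back regular functions to regular functions. -/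
class AffineAlgebraicGroup (K : Type u) [Field K] (G : Type v) [Group G] where
  /-- The algebra of regular functions. -/
  regular : Subalgebra K (G → K)
  fg : regular.FG
  exists_unique_point : ∀ φ : regular →ₐ[K] K, ∃! g : G, ∀ f : regular, φ f = (f : G → K) g
  regular_mul : ∀ f ∈ regular, (fun x : G × G => f (x.1 * x.2)) ∈
    Submodule.span K {F : G × G → K | ∃ a ∈ regular, ∃ b ∈ regular, F = fun x => a x.1 * b x.2}
  regular_inv : ∀ f ∈ regular, (fun g => f g⁻¹) ∈ regular

/-- A representation is rational if all its matrix coefficients are regular functions. -/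
def IsRational {G : Type v} [Group G] [AffineAlgebraicGroup K G] {W : Type*} [AddCommGroup W]
    [Module K W] (ρ : Representation K G W) : Prop :=
  ∀ (w : W) (φ : Module.Dual K W),
    (fun g => φ (ρ g w)) ∈ AffineAlgebraicGroup.regular (K := K) (G := G)

/-- `G` is reductive: all its finite dimensional rational representations are completely
reducible. -/
def IsReductive (K : Type u) [Field K] (G : Type v) [Group G] [AffineAlgebraicGroup K G] : Prop :=
  ∀ (W : Type u) [AddCommGroup W] [Module K W] [FiniteDimensional K W] (ρ : Representation K G W),
    IsRational ρ → ρ.IsSemisimpleRepresentation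

/-! ### Polynomial maps and polynomial functors -/

/-- A map between vector spaces is a homogeneous polynomial map of degree `k` if it is the
restriction to the diagonal of a `k`-linear map. -/
def IsHomogeneousPolynomialMap (K : Type u) [Field K] (k : ℕ) {M N : Type*} [AddCommGroup M]
    [Module K M] [AddCommGroup N] [Module K N] (f : M → N) : Prop :=
  ∃ φ : MultilinearMap K (fun _ : Fin k => M) N, ∀ x, f x = φ fun _ => x

/-- The action of a functor `P` on linear maps. -/
def functorMap (P : FGModuleCat.{u} K ⥤ FGModuleCat.{u} K) {U W : Type u} [AddCommGroup U]
    [Module K U] [Module.Finite K U] [AddCommGroup W] [Module K W] [Module.Finite K W]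
    (f : U →ₗ[K] W) : P.obj (FGModuleCat.of K U) →ₗ[K] P.obj (FGModuleCat.of K W) :=
  (P.map (FGModuleCat.ofHom f)).hom.hom

/-- `P` is a homogeneous polynomial functor of degree `k`: for all finite dimensional `U`, `W` the
map `Hom(U, W) → Hom(P(U), P(W))` is homogeneous polynomial of degree `k`. -/
def IsHomogeneousPolynomialFunctor (k : ℕ) (P : FGModuleCat.{u} K ⥤ FGModuleCat.{u} K) : Prop :=
  ∀ (U W : Type u) [AddCommGroup U] [Module K U] [Module.Finite K U] [AddCommGroup W]
    [Module K W] [Module.Finite K W],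
    IsHomogeneousPolynomialMap K k fun f : U →ₗ[K] W => functorMap P f

/-- `F` is a character of `P`: for every invertible diagonal matrix `A` with diagonal entries
`a₁, …, aₙ` one has `F(a₁, …, aₙ, 0, 0, …) = Tr P(A)`. -/
def IsCharacter (P : FGModuleCat.{u} K ⥤ FGModuleCat.{u} K) (F : SymFun K) : Prop :=
  ∀ (n : ℕ) (a : Fin n → Kˣ), evalFin F (fun i => (a i : K)) =
    LinearMap.trace K _ (functorMap P (Matrix.toLin' (Matrix.diagonal fun i => (a i : K))))

/-- The character `ch P`, the symmetric function determined by `IsCharacter P`. -/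
def character (P : FGModuleCat.{u} K ⥤ FGModuleCat.{u} K) : SymFun K :=
  Classical.epsilon (IsCharacter P)

/-- The representation of `G` on `P(V)`, in which `g` acts as `P(ρ g)`. -/
def functorRep (P : FGModuleCat.{u} K ⥤ FGModuleCat.{u} K) {G : Type v} [Group G] {V : Type u}
    [AddCommGroup V] [Module K V] [Module.Finite K V] (ρ : Representation K G V) :
    Representation K G (P.obj (FGModuleCat.of K V)) where
  toFun g := functorMap P (ρ g)
  map_one' := by
    have h : FGModuleCat.ofHom (ρ 1) = 𝟙 (FGModuleCat.of K V) := by rw [map_one]; rfl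
    unfold functorMap
    rw [h, P.map_id]
    rfl
  map_mul' g g' := by
    have h : FGModuleCat.ofHom (ρ (g * g')) =
        FGModuleCat.ofHom (ρ g') ≫ FGModuleCat.ofHom (ρ g) := by rw [map_mul]; rfl
    unfold functorMap
    rw [h, P.map_comp]
    rfl

/-! ### Tensor invariants and invariant polynomials -/

open scoped TensorProduct

section

variable {G : Type v} [Group G] {V : Type*} [AddCommGroup V] [Module K V]

/-- The diagonal action of `G` on `V^{⊗ n}`. -/
def tensorRep (ρ : Representation K G V) (n : ℕ) : Representation K G (⨂[K] _ : Fin n, V) where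
  toFun g := PiTensorProduct.map fun _ => ρ g
  map_one' := by
    simp only [map_one]
    exact PiTensorProduct.map_one
  map_mul' g h := by
    simp only [map_mul]
    exact PiTensorProduct.map_mul _ _

/-- The action of the symmetric group on `V^{⊗ n}` by permuting the tensor factors. -/
def permRep (K : Type u) [Field K] (V : Type*) [AddCommGroup V] [Module K V] (n : ℕ) :
    Representation K (Equiv.Perm (Fin n)) (⨂[K] _ : Fin n, V) where
  toFun π := (PiTensorProduct.reindex K (fun _ : Fin n => V) π).toLinearMap
  map_one' := by
    ext x
    simp only [LinearMap.compMultilinearMap_apply, LinearEquiv.coe_coe]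
    erw [PiTensorProduct.reindex_tprod]
    rfl
  map_mul' π σ := by
    ext x
    simp only [LinearMap.compMultilinearMap_apply, LinearEquiv.coe_coe, Module.End.mul_apply]
    erw [PiTensorProduct.reindex_tprod, PiTensorProduct.reindex_tprod,
      PiTensorProduct.reindex_tprod]
    rfl

/-- The subspace `(V^{⊗ n})^G` is stable under the symmetric group. -/
def tensorInvariants (ρ : Representation K G V) (n : ℕ) : Subrepresentation (permRep K V n) where
  toSubmodule := (tensorRep ρ n).invariants
  apply_mem_toSubmodule π x hx g := by
    have h := PiTensorProduct.map_reindex (R := K) (fun _ : Fin n => ρ g) π x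
    exact h.trans (congrArg _ (hx g))

/-- `I_n(V)`: the Frobenius character of the representation of the symmetric group on
`(V^{⊗ n})^G`. -/
def tensorInvariantCharacter (ρ : Representation K G V) (n : ℕ) : SymFun K :=
  frobeniusCharacter (tensorInvariants ρ n).toRepresentation

/-- The space of `G`-invariant homogeneous polynomials (polynomial functions) of degree `r`
on `V`. -/
def invariantPolynomials (ρ : Representation K G V) (r : ℕ) : Submodule K (V → K) where
  carrier := {f | IsHomogeneousPolynomialMap K r f ∧ ∀ g v, f (ρ g v) = f v}
  zero_mem' := ⟨⟨0, fun _ => rfl⟩, fun _ _ => rfl⟩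
  add_mem' := by
    rintro f f' ⟨⟨φ, hφ⟩, hf⟩ ⟨⟨φ', hφ'⟩, hf'⟩
    exact ⟨⟨φ + φ', fun x => by simp [hφ, hφ']⟩, fun g v => by simp [hf, hf']⟩
  smul_mem' := by
    rintro c f ⟨⟨φ, hφ⟩, hf⟩
    exact ⟨⟨c • φ, fun x => by simp [hφ]⟩, fun g v => by simp [hf]⟩

/-- The Hilbert series of the graded ring of `G`-invariant polynomials on `V`. -/
def hilbertSeries (ρ : Representation K G V) : PowerSeries ℕ :=
  PowerSeries.mk fun r => Module.finrank K (invariantPolynomials ρ r)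

end

end TensorInvariants

end

/-! On a given finite dimensional rational representation, complete reducibility yields a finite
combination `c` of points of `G`, with coefficient sum one, that acts as a projection onto the
invariants (`IsReductive.exists_isReynolds`). It plays the part of integration over a compact group:
the dimension of the invariants, and the trace on them of an operator preserving them, become
averages over `g` of ordinary traces.

Write q(A) for the value of a polynomial q in the power sums when p_m is replaced by Tr(A^m)
(`traceEval`). This replaces evaluation at eigenvalues, so nothing has to be diagonalized. The trace
of π composed with A^{⊗n} is p_{λ(π)}(A). Hence I_n(V) = (1/n!) Σ_π L(p_{λ(π)}) p_{λ(π)}, where L(q)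
is the average of q(g). As n!/z_λ permutations have cycle type λ, it follows that ⟨q, I_n(V)⟩ = L(q)
for q homogeneous of degree n (`hallInner_aeval`).

On the other side, the invariant polynomials of degree r on W = P(V) are the invariants of S_r × G
in the dual of W^{⊗r}, and there are as many in W^{⊗r} itself. Their dimension is the average of
(1/r!) Σ_τ p_{λ(τ)}(P(g)) = h_r(P(g)). Polarization and reduction to operators of rank one show that
Tr P(A) = (ch P)(A) for every endomorphism A (`trace_functorMap`). Applied to the powers of g, this
turns h_r(P(g)) into h_r[ch P](g). So both sides of the theorem equal L(h_r[ch P]), provided that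
the same `c` serves V^{⊗rk} and P(V)^{⊗r}; it is therefore chosen for their direct sum. -/

noncomputable section

namespace TensorInvariants

variable {K : Type u} [Field K]

/-! ### Evaluation of symmetric functions -/

/-- The restriction of a symmetric function to finitely many variables is a polynomial. -/
theorem exists_coe_eq_killCompl (n : ℕ) (f : SymFun K) : ∃ q : MvPolynomial (Fin n) K,
    (q : MvPowerSeries (Fin n) K) =
      MvPowerSeries.killCompl Fin.valEmbedding (f : MvPowerSeries ℕ K) := by
  classical
  obtain ⟨f, hf, N, hN⟩ := f
  have hfin : {d : Fin n →₀ ℕ | d.degree ≤ N}.Finite := Finsupp.finite_of_degree_le N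
  refine ⟨∑ d ∈ hfin.toFinset, MvPolynomial.monomial d
    (MvPowerSeries.coeff (d.embDomain Fin.valEmbedding) f), ?_⟩
  ext d
  rw [MvPolynomial.coeff_coe, MvPolynomial.coeff_sum, MvPowerSeries.coeff_killCompl]
  simp only [MvPolynomial.coeff_monomial]
  rw [Finset.sum_ite_eq']
  split_ifs with h
  · rfl
  · refine (hN _ ?_).symm
    have h1 : (d.embDomain Fin.valEmbedding).degree = d.degree := by
      rw [Finsupp.degree_apply, Finsupp.degree_apply, Finsupp.support_embDomain, Finset.sum_map]
      exact Finset.sum_congr rfl fun i _ => Finsupp.embDomain_apply_self _ _ _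
    rw [h1]
    simpa using h

/-- The polynomial in `n` variables obtained from a symmetric function by setting all other
variables to zero. -/
def finPoly (n : ℕ) (f : SymFun K) : MvPolynomial (Fin n) K :=
  (exists_coe_eq_killCompl n f).choose

theorem coe_finPoly (n : ℕ) (f : SymFun K) : (finPoly n f : MvPowerSeries (Fin n) K) =
    MvPowerSeries.killCompl Fin.valEmbedding (f : MvPowerSeries ℕ K) :=
  (exists_coe_eq_killCompl n f).choose_spec

theorem coeff_finPoly (n : ℕ) (f : SymFun K) (d : Fin n →₀ ℕ) : (finPoly n f).coeff d =
    MvPowerSeries.coeff (d.embDomain Fin.valEmbedding) (f : MvPowerSeries ℕ K) := by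
  rw [← MvPolynomial.coeff_coe, coe_finPoly, MvPowerSeries.coeff_killCompl]

theorem evalFin_eq_eval (f : SymFun K) {n : ℕ} (a : Fin n → K) :
    evalFin f a = MvPolynomial.eval a (finPoly n f) := by
  rw [MvPolynomial.eval_eq', evalFin, finsum_eq_sum_of_support_subset]
  · exact Finset.sum_congr rfl fun d _ => by rw [coeff_finPoly]
  · intro d hd
    rw [Function.mem_support, ← coeff_finPoly] at hd
    exact MvPolynomial.mem_support_iff.2 (left_ne_zero_of_mul hd)

/-- Evaluation of symmetric functions at a finite tuple, as a homomorphism of algebras. -/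
def evalFinHom {n : ℕ} (a : Fin n → K) : SymFun K →ₐ[K] K :=
  (MvPolynomial.aeval a).comp
    { toFun := finPoly n
      map_one' := MvPolynomial.coe_injective _ _ (by rw [coe_finPoly]; simp)
      map_zero' := MvPolynomial.coe_injective _ _ (by rw [coe_finPoly]; simp)
      map_mul' := fun f g => MvPolynomial.coe_injective _ _ (by
        rw [MvPolynomial.coe_mul]; simp only [coe_finPoly]; simp)
      map_add' := fun f g => MvPolynomial.coe_injective _ _ (by
        rw [MvPolynomial.coe_add]; simp only [coe_finPoly]; simp)
      commutes' := fun c => MvPolynomial.coe_injective _ _ (by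
        rw [coe_finPoly, Subalgebra.coe_algebraMap, AlgHom.commutes]
        simp [MvPolynomial.algebraMap_eq, MvPowerSeries.algebraMap_apply]) }

theorem evalFinHom_apply {n : ℕ} (a : Fin n → K) (f : SymFun K) : evalFinHom a f = evalFin f a := by
  rw [evalFin_eq_eval]
  rfl

theorem evalFinHom_powerSum {n : ℕ} (a : Fin n → K) (m : ℕ+) :
    evalFinHom a (powerSum K m) = ∑ i, a i ^ (m : ℕ) := by
  classical
  rw [evalFinHom_apply, evalFin_eq_eval]
  have h : finPoly n (powerSum K m) = ∑ i, MvPolynomial.X i ^ (m : ℕ) := by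
    ext d
    rw [coeff_finPoly, MvPolynomial.coeff_sum]
    simp only [MvPolynomial.coeff_X_pow]
    change (if _ then _ else _ : K) = _
    split_ifs with h
    · obtain ⟨i, hi⟩ := h
      have hm : (d.embDomain Fin.valEmbedding) i ≠ 0 := by
        rw [hi, Finsupp.single_eq_same]; exact m.ne_zero
      have hr : i ∈ (d.embDomain Fin.valEmbedding).support := Finsupp.mem_support_iff.2 hm
      rw [Finsupp.support_embDomain, Finset.mem_map] at hr
      obtain ⟨j, -, rfl⟩ := hr
      have hd : d = Finsupp.single j (m : ℕ) :=
        Finsupp.embDomain_injective Fin.valEmbedding (by rw [hi, Finsupp.embDomain_single])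
      rw [Finset.sum_eq_single j]
      · rw [if_pos hd.symm]
      · intro b _ hb
        rw [if_neg]
        rw [hd]
        intro h
        exact hb (Finsupp.single_left_injective m.ne_zero h)
      · simp
    · refine (Finset.sum_eq_zero fun i _ => if_neg ?_).symm
      rintro rfl
      exact h ⟨i, Finsupp.embDomain_single _ _ _⟩
  rw [h]
  simp

/-- A symmetric function is determined by its values at tuples of nonzero elements. -/
theorem symFun_ext [CharZero K] {f g : SymFun K}
    (h : ∀ (n : ℕ) (a : Fin n → Kˣ),
      evalFin f (fun i => (a i : K)) = evalFin g fun i => (a i : K)) :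
    f = g := by
  have hfin : ∀ n, finPoly n f = finPoly n g := by
    intro n
    -- The nonzero elements form an infinite set, so invertible tuples suffice to identify a
    -- polynomial.
    refine MvPolynomial.funext_set (fun _ => {x : K | x ≠ 0}) (fun _ => ?_) fun x hx => ?_
    · exact (Set.finite_singleton (0 : K)).infinite_compl
    · have hx' : ∀ i, x i ≠ 0 := fun i => hx i (Set.mem_univ i)
      have := h n fun i => Units.mk0 (x i) (hx' i)
      simpa [evalFin_eq_eval] using this
  refine Subtype.ext (MvPowerSeries.ext fun d => ?_)
  obtain ⟨n, hn⟩ : ∃ n, ∀ i ∈ d.support, i < n :=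
    ⟨d.support.sup id + 1, fun i hi => Nat.lt_succ_of_le (Finset.le_sup (f := id) hi)⟩
  have hd : d ∈ Set.range (Finsupp.embDomain (M := ℕ) (Fin.valEmbedding (n := n))) := by
    rw [Finsupp.mem_range_embDomain_iff]
    intro i hi
    exact ⟨⟨i, hn i hi⟩, rfl⟩
  obtain ⟨d, rfl⟩ := hd
  rw [← coeff_finPoly, ← coeff_finPoly, hfin]

/-! ### Expansion in power sums -/

/-- The power sums are algebraically independent. -/
theorem aeval_powerSum_injective [CharZero K] :
    Function.Injective (MvPolynomial.aeval (R := K) (powerSum K)) := by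
  classical
  rw [injective_iff_map_eq_zero]
  intro f hf
  refine MvPolynomial.funext fun t => ?_
  rw [map_zero]
  obtain ⟨N, hN⟩ : ∃ N : ℕ, ∀ m ∈ f.vars, (m : ℕ) ≤ N :=
    ⟨f.vars.sup fun m => (m : ℕ), fun m hm => Finset.le_sup (f := fun m : ℕ+ => (m : ℕ)) hm⟩
  -- The variable `X i` is the multiplicity of the value i + 1 in a tuple; the m-th power sum of
  -- such a tuple is linear in the multiplicities.
  set g : MvPolynomial (Fin N) K := MvPolynomial.aeval (fun m : ℕ+ =>
    ∑ i : Fin N, MvPolynomial.C (((i : ℕ) + 1 : K) ^ (m : ℕ)) * MvPolynomial.X i) f with hg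
  have hgeval : ∀ c : Fin N → K, MvPolynomial.eval c g =
      MvPolynomial.eval (fun m : ℕ+ => ∑ i : Fin N, ((i : ℕ) + 1 : K) ^ (m : ℕ) * c i) f := by
    intro c
    rw [hg, ← MvPolynomial.coe_aeval_eq_eval, RingHom.coe_coe, ← AlgHom.comp_apply,
      MvPolynomial.comp_aeval, ← MvPolynomial.coe_aeval_eq_eval]
    simp
  have hg0 : g = 0 := by
    refine MvPolynomial.funext_set (fun _ => Set.range (Nat.cast : ℕ → K))
      (fun _ => Set.infinite_range_of_injective Nat.cast_injective) fun x hx => ?_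
    have hx' : ∀ i, ∃ c : ℕ, (c : K) = x i := fun i => hx i (Set.mem_univ i)
    choose c hc using hx'
    rw [hgeval, map_zero]
    -- For natural multiplicities an actual tuple exists, with `c i` entries equal to i + 1, and the
    -- relation `hf` can be evaluated there.
    let e := finSigmaFinEquiv (n := c)
    have h1 := congrArg (evalFinHom fun j => (((e.symm j).1 : ℕ) + 1 : K)) hf
    rw [map_zero, ← AlgHom.comp_apply, MvPolynomial.comp_aeval, MvPolynomial.aeval_eq_eval] at h1
    refine Eq.trans (congrArg (fun s => MvPolynomial.eval s f) (funext fun m => ?_)) h1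
    rw [evalFinHom_powerSum]
    rw [← e.sum_comp]
    simp only [Equiv.symm_apply_apply]
    rw [Fintype.sum_sigma]
    refine Finset.sum_congr rfl fun i _ => ?_
    simp [← hc, mul_comm]
  -- By Vandermonde, arbitrary values of p_1, …, p_N arise from suitable multiplicities in `K`. The
  -- nodes i + 1 are nonzero, as needed because the exponents start at 1.
  let M : Matrix (Fin N) (Fin N) K := fun j i => ((i : ℕ) + 1 : K) ^ ((j : ℕ) + 1)
  have hM : IsUnit M := by
    have hM' : M = (Matrix.vandermonde fun i : Fin N => ((i : ℕ) + 1 : K)).transpose *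
        Matrix.diagonal fun i : Fin N => ((i : ℕ) + 1 : K) := by
      ext j i
      simp [M, Matrix.mul_diagonal, Matrix.vandermonde_apply, pow_succ]
    rw [hM', Matrix.isUnit_iff_isUnit_det, Matrix.det_mul, Matrix.det_transpose,
      Matrix.det_diagonal, isUnit_iff_ne_zero]
    refine mul_ne_zero (Matrix.det_vandermonde_ne_zero_iff.2 fun i j h => ?_)
      (Finset.prod_ne_zero_iff.2 fun i _ => Nat.cast_add_one_ne_zero _)
    exact Fin.ext (by simpa using h)
  obtain ⟨c, hc⟩ := (Matrix.mulVec_surjective_iff_isUnit.2 hM)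
    fun j : Fin N => t ⟨j + 1, j.1.succ_pos⟩
  have h2 := hgeval c
  rw [hg0, map_zero] at h2
  rw [h2]
  refine MvPolynomial.eval₂Hom_congr' rfl ?_ rfl
  intro m hm _
  have hm1 := m.pos
  have := congrFun hc ⟨m - 1, by have := hN m hm; omega⟩
  simp only [Matrix.mulVec, dotProduct, M] at this
  have h3 : (m : ℕ) - 1 + 1 = m := by omega
  simp only [h3] at this
  rw [this]
  rfl

/-- Injectivity makes `Function.invFun` a left inverse. Generation of Λ by the power sums is never
needed below, since every symmetric function to be expanded comes with an explicit expansion. -/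
theorem powerSumExpansion_aeval [CharZero K] (q : MvPolynomial ℕ+ K) :
    powerSumExpansion (MvPolynomial.aeval (powerSum K) q) = q :=
  Function.leftInverse_invFun aeval_powerSum_injective q

/-- The substitution `g ↦ p_n[g]` is a homomorphism of algebras. -/
def powerSubstHom (n : ℕ+) : SymFun K →ₐ[K] SymFun K :=
  AlgHom.codRestrict ((MvPowerSeries.expand n n.ne_zero).comp (SymFun K).val) (SymFun K)
    fun g => (powerSubst n g).2

theorem powerSubstHom_apply (n : ℕ+) (g : SymFun K) : powerSubstHom n g = powerSubst n g := rfl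

theorem powerSubst_powerSum (n m : ℕ+) : powerSubst n (powerSum K m) = powerSum K (n * m) := by
  classical
  refine Subtype.ext (MvPowerSeries.ext fun d => ?_)
  change MvPowerSeries.coeff d (MvPowerSeries.expand n n.ne_zero _) = if _ then _ else _
  by_cases h : ∃ i, ¬ (n : ℕ) ∣ d i
  · obtain ⟨i, hi⟩ := h
    rw [MvPowerSeries.coeff_expand_of_not_dvd _ _ _ hi, if_neg]
    rintro ⟨j, rfl⟩
    refine hi ?_
    rw [Finsupp.single_apply]
    split_ifs <;> simp
  · push Not at h
    obtain ⟨d, rfl⟩ : ∃ m : ℕ →₀ ℕ, d = (n : ℕ) • m :=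
      ⟨d.mapRange (fun k => k / (n : ℕ)) (Nat.zero_div _), by
        ext i
        simp [Nat.mul_div_cancel' (h i)]⟩
    rw [MvPowerSeries.coeff_expand_smul]
    change (if _ then _ else _ : K) = _
    congr 1
    refine propext (exists_congr fun i => ?_)
    rw [PNat.mul_coe, ← smul_eq_mul, ← Finsupp.smul_single]
    exact (smul_right_injective _ n.ne_zero).eq_iff.symm

theorem powerSubst_aeval (n : ℕ+) (q : MvPolynomial ℕ+ K) :
    powerSubst n (MvPolynomial.aeval (powerSum K) q) =
      MvPolynomial.aeval (powerSum K)
        (MvPolynomial.aeval (fun m => (MvPolynomial.X (n * m) : MvPolynomial ℕ+ K)) q) := by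
  rw [← powerSubstHom_apply, ← AlgHom.comp_apply, ← AlgHom.comp_apply, MvPolynomial.comp_aeval,
    MvPolynomial.comp_aeval]
  congr 2
  ext m
  simp [powerSubstHom_apply, powerSubst_powerSum]

/-- Plethysm in terms of expansions in power sums. -/
theorem plethysm_aeval [CharZero K] (p q : MvPolynomial ℕ+ K) :
    plethysm (MvPolynomial.aeval (powerSum K) p) (MvPolynomial.aeval (powerSum K) q) =
      MvPolynomial.aeval (powerSum K) (MvPolynomial.aeval (fun n => MvPolynomial.aeval
        (fun m => (MvPolynomial.X (n * m) : MvPolynomial ℕ+ K)) q) p) := by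
  rw [plethysm, powerSumExpansion_aeval, ← AlgHom.comp_apply, MvPolynomial.comp_aeval]
  simp only [powerSubst_aeval]

/-! ### Traces of permuted tensor powers of a matrix -/

/-- The trace of a permutation composed with a tensor power of a matrix. -/
def cycleSum {ι α : Type*} [Fintype ι] [Fintype α] [DecidableEq α] (A : Matrix ι ι K)
    (σ : Equiv.Perm α) : K :=
  ∑ i : α → ι, ∏ j, A (i (σ j)) (i j)

section cycleSum

variable {ι : Type*} [Fintype ι]

/-- A matrix power is a sum over paths. The arbitrary kernel `F` on the endpoints makes the
induction work: summing over the first vertex absorbs its edge into a new kernel. -/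
theorem sum_path_eq [DecidableEq ι] (A : Matrix ι ι K) (m : ℕ) (F : ι → ι → K) :
    ∑ i : Fin (m + 1) → ι, F (i 0) (i (Fin.last m)) * ∏ k : Fin m, A (i k.succ) (i k.castSucc) =
      ∑ x, ∑ y, F x y * (A ^ m) y x := by
  induction m generalizing F with
  | zero =>
    rw [← (Equiv.funUnique (Fin 1) ι).symm.sum_comp]
    simp [Matrix.one_apply]
  | succ m ih =>
    rw [← (Fin.consEquiv fun _ => ι).sum_comp, Fintype.sum_prod_type, Finset.sum_comm]
    have h : ∀ i : Fin (m + 1) → ι, ∑ x, F ((Fin.consEquiv fun _ => ι) (x, i) 0)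
        ((Fin.consEquiv fun _ => ι) (x, i) (Fin.last (m + 1))) *
        ∏ k : Fin (m + 1), A ((Fin.consEquiv fun _ => ι) (x, i) k.succ)
          ((Fin.consEquiv fun _ => ι) (x, i) k.castSucc) =
        (∑ x, F x (i (Fin.last m)) * A (i 0) x) *
          ∏ k : Fin m, A (i k.succ) (i k.castSucc) := by
      intro i
      rw [Finset.sum_mul]
      refine Finset.sum_congr rfl fun x _ => ?_
      rw [Fin.prod_univ_succ]
      simp [Fin.consEquiv, ← Fin.succ_last, mul_assoc]
    rw [Finset.sum_congr rfl fun i _ => h i, ih fun y z => ∑ x, F x z * A y x]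
    simp only [pow_succ, Matrix.mul_apply, Finset.sum_mul, Finset.mul_sum]
    rw [Finset.sum_comm]
    conv_rhs => rw [Finset.sum_comm]
    refine Finset.sum_congr rfl fun z _ => ?_
    rw [Finset.sum_comm]
    exact Finset.sum_congr rfl fun x _ => Finset.sum_congr rfl fun y _ => by ring

/-- Listing the points as x, τ x, τ² x, … turns the sum into one over closed paths. -/
theorem cycleSum_of_sameCycle [DecidableEq ι] {β : Type*} [Fintype β] [DecidableEq β]
    (A : Matrix ι ι K) (τ : Equiv.Perm β) (x : β) (h : ∀ y z, τ.SameCycle y z) :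
    cycleSum A τ = Matrix.trace (A ^ Fintype.card β) := by
  have hc : τ.IsCycleOn (Finset.univ : Finset β) := by
    simpa using ⟨τ.bijective.bijOn_univ, fun y _ z _ => h y z⟩
  obtain ⟨m, hm⟩ : ∃ m, Fintype.card β = m + 1 :=
    Nat.exists_eq_succ_of_ne_zero (Fintype.card_pos_iff.2 ⟨x⟩).ne'
  have hbij : Function.Bijective fun k : Fin (m + 1) => (τ ^ (k : ℕ)) x := by
    rw [Fintype.bijective_iff_surjective_and_card]
    refine ⟨fun y => ?_, by simp [hm]⟩
    obtain ⟨k, hk, hky⟩ := hc.exists_pow_eq (Finset.mem_univ x) (Finset.mem_univ y)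
    rw [Finset.card_univ, hm] at hk
    exact ⟨⟨k, hk⟩, hky⟩
  let e : Fin (m + 1) ≃ β := Equiv.ofBijective _ hbij
  have he : ∀ k : Fin m, e k.succ = τ (e k.castSucc) := fun k => by
    simp [e, pow_succ']
  have he0 : e 0 = τ (e (Fin.last m)) := by
    have h1 := hc.pow_card_apply (Finset.mem_univ x)
    rw [Finset.card_univ, hm, pow_succ'] at h1
    simpa [e] using h1.symm
  rw [hm, cycleSum, ← (e.arrowCongr (Equiv.refl ι)).sum_comp]
  have h2 : ∀ i : Fin (m + 1) → ι, ∏ j, A ((e.arrowCongr (Equiv.refl ι)) i (τ j))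
      ((e.arrowCongr (Equiv.refl ι)) i j) =
      A (i 0) (i (Fin.last m)) * ∏ k : Fin m, A (i k.succ) (i k.castSucc) := by
    intro i
    rw [← e.prod_comp, Fin.prod_univ_castSucc, mul_comm]
    simp [← he, ← he0]
  rw [Finset.sum_congr rfl fun i _ => h2 i, sum_path_eq A m fun y z => A y z]
  simp [Matrix.trace, pow_succ', Matrix.mul_apply]

/-- The sum `cycleSum` is multiplicative over a partition into stable subsets. -/
theorem cycleSum_eq_prod_fiber {α Q : Type*} [Fintype α] [DecidableEq α] [Fintype Q]
    [DecidableEq Q] (A : Matrix ι ι K) (σ : Equiv.Perm α) (f : α → Q) (hf : ∀ j, f (σ j) = f j) :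
    cycleSum A σ =
      ∏ q, cycleSum A (σ.subtypePerm (p := fun j => f j = q) fun j => by rw [hf]) := by
  simp only [cycleSum]
  rw [Finset.prod_univ_sum, Fintype.piFinset_univ]
  let E : (∀ q, {j // f j = q} → ι) ≃ (α → ι) :=
    (Equiv.piCurry fun _ _ => ι).symm.trans
      ((Equiv.sigmaFiberEquiv f).arrowCongr (Equiv.refl ι))
  have hE : ∀ (i : ∀ q, {j // f j = q} → ι) (q : Q) (j : {j // f j = q}), E i j = i q j := by
    rintro i q ⟨j, rfl⟩
    rfl
  rw [← E.sum_comp]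
  refine Finset.sum_congr rfl fun i _ => ?_
  rw [← (Equiv.sigmaFiberEquiv f).prod_comp, Fintype.prod_sigma]
  refine Finset.prod_congr rfl fun q _ => Finset.prod_congr rfl fun j _ => ?_
  rw [← hE i q j, ← hE i q (σ.subtypePerm _ j)]
  rfl

/-- The trace of a permutation composed with a tensor power of a matrix is the product over the
cycles of the traces of powers of the matrix. -/
theorem cycleSum_eq_prod_parts [DecidableEq ι] {α : Type*} [Fintype α] [DecidableEq α]
    (A : Matrix ι ι K) (σ : Equiv.Perm α) :
    cycleSum A σ = (σ.partition.parts.map fun m => Matrix.trace (A ^ m)).prod := by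
  -- Each point is labelled by its cycle; fixed points need labels of their own because
  -- `cycleFactorsFinset` omits trivial cycles.
  let f : α → σ.cycleFactorsFinset ⊕ {x // σ x = x} := fun x =>
    if h : σ x = x then Sum.inr ⟨x, h⟩ else
      Sum.inl ⟨σ.cycleOf x, Equiv.Perm.cycleOf_mem_cycleFactorsFinset_iff.2
        (Equiv.Perm.mem_support.2 h)⟩
  have hinl : ∀ (c : σ.cycleFactorsFinset) (x : α),
      f x = Sum.inl c ↔ x ∈ (c : Equiv.Perm α).support := by
    rintro ⟨c, hc⟩ x
    by_cases h : σ x = x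
    · simp only [f, dif_pos h, reduceCtorEq, false_iff]
      intro hx
      exact Equiv.Perm.mem_support.1
        (Equiv.Perm.mem_cycleFactorsFinset_support_le hc hx) h
    · simp only [f, dif_neg h, Sum.inl.injEq, Subtype.mk.injEq]
      constructor
      · rintro rfl
        exact Equiv.Perm.mem_support_cycleOf_iff.2
          ⟨Equiv.Perm.SameCycle.refl _ _, Equiv.Perm.mem_support.2 h⟩
      · intro hx
        exact (Equiv.Perm.cycle_is_cycleOf hx hc).symm
  have hinr : ∀ (y : {x // σ x = x}) (x : α), f x = Sum.inr y ↔ x = y := by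
    rintro ⟨y, hy⟩ x
    by_cases h : σ x = x
    · simp [f, dif_pos h]
    · simp only [f, dif_neg h, reduceCtorEq, false_iff]
      rintro rfl
      exact h hy
  have hf : ∀ j, f (σ j) = f j := by
    intro j
    rcases h : f j with c | y
    · rw [hinl] at h ⊢
      have h1 := (Equiv.Perm.mem_cycleFactorsFinset_iff.1 c.2).2 j h
      rw [← h1]
      exact Equiv.Perm.apply_mem_support.2 h
    · rw [hinr] at h ⊢
      rw [h, y.2]
  rw [cycleSum_eq_prod_fiber A σ f hf, Fintype.prod_sum_type, Equiv.Perm.parts_partition,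
    Multiset.map_add, Multiset.prod_add, Equiv.Perm.cycleType_def, Multiset.map_map,
    Multiset.map_replicate, Multiset.prod_replicate]
  congr 1
  · change _ = ∏ c ∈ σ.cycleFactorsFinset, Matrix.trace (A ^ c.support.card)
    refine Eq.trans (Finset.prod_congr rfl fun c _ => ?_)
      (Finset.prod_coe_sort σ.cycleFactorsFinset fun c => Matrix.trace (A ^ c.support.card))
    obtain ⟨x, hx⟩ := (Equiv.Perm.mem_cycleFactorsFinset_iff.1 c.2).1.nonempty_support
    rw [cycleSum_of_sameCycle A _ ⟨x, (hinl c x).2 hx⟩]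
    · rw [Fintype.card_of_subtype _ fun y => (hinl c y).symm]
    · rintro ⟨y, hy⟩ ⟨z, hz⟩
      rw [Equiv.Perm.sameCycle_subtypePerm]
      rw [hinl] at hy hz
      rw [Equiv.Perm.cycle_is_cycleOf hy c.2] at hz
      exact (Equiv.Perm.mem_support_cycleOf_iff.1 hz).1
  · have h1 : ∀ y : {x // σ x = x}, cycleSum A (σ.subtypePerm (p := fun j => f j = Sum.inr y)
        fun j => by rw [hf]) = Matrix.trace (A ^ 1) := by
      intro y
      have hs : Subsingleton {j // f j = Sum.inr y} :=
        ⟨fun a b => Subtype.ext (((hinr y a).1 a.2).trans ((hinr y b).1 b.2).symm)⟩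
      have hy : f y = Sum.inr y := (hinr y y).2 rfl
      rw [cycleSum_of_sameCycle A _ ⟨y, hy⟩ fun a b => by
        rw [Subsingleton.elim a b],
        Fintype.card_eq_one_iff.2 ⟨⟨y, hy⟩, fun a => Subsingleton.elim _ _⟩]
    rw [Finset.prod_congr rfl fun y _ => h1 y, Finset.prod_const, Finset.card_univ]
    congr 1
    rw [← Finset.card_compl]
    rw [Fintype.card_subtype]
    congr 1
    ext x
    simp

end cycleSum

/-! ### Cycle monomials -/

/-- The lengths of the cycles of a permutation, as positive natural numbers. -/
def cycleLengths {n : ℕ} (π : Equiv.Perm (Fin n)) : Multiset ℕ+ :=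
  π.partition.parts.attach.map fun i => ⟨i.1, π.partition.parts_pos i.2⟩

theorem map_coe_cycleLengths {n : ℕ} (π : Equiv.Perm (Fin n)) :
    (cycleLengths π).map (fun m : ℕ+ => (m : ℕ)) = π.partition.parts :=
  (Multiset.map_map _ _ _).trans (Multiset.attach_map_val _)

/-- The monomial in the variables `X m` given by the cycle lengths of a permutation. -/
def cycleMonomial (K : Type u) [Field K] {n : ℕ} (π : Equiv.Perm (Fin n)) : MvPolynomial ℕ+ K :=
  ((cycleLengths π).map MvPolynomial.X).prod

theorem prod_map_X_eq_monomial {τ : Type*} [DecidableEq τ] (s : Multiset τ) :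
    (s.map MvPolynomial.X).prod = MvPolynomial.monomial (Multiset.toFinsupp s) (1 : K) := by
  induction s using Multiset.induction_on with
  | empty => simp
  | cons a s ih =>
    rw [Multiset.map_cons, Multiset.prod_cons, ih, ← Multiset.singleton_add, map_add,
      Multiset.toFinsupp_singleton, MvPolynomial.X, MvPolynomial.monomial_mul, one_mul]

theorem cycleMonomial_eq {n : ℕ} (π : Equiv.Perm (Fin n)) : cycleMonomial K π =
    MvPolynomial.monomial (Multiset.toFinsupp (cycleLengths π)) 1 :=
  prod_map_X_eq_monomial _

theorem aeval_cycleMonomial {R : Type*} [CommSemiring R] [Algebra K R] (t : ℕ+ → R) {n : ℕ}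
    (π : Equiv.Perm (Fin n)) :
    MvPolynomial.aeval t (cycleMonomial K π) = ((cycleLengths π).map t).prod := by
  rw [cycleMonomial, map_multiset_prod, Multiset.map_map]
  simp

theorem aeval_powerSum_cycleMonomial {n : ℕ} (π : Equiv.Perm (Fin n)) :
    MvPolynomial.aeval (powerSum K) (cycleMonomial K π) = cyclePowerSum K π := by
  rw [aeval_cycleMonomial]
  exact congrArg Multiset.prod (Multiset.map_map _ _ _)

/-- The substitution of the traces of the powers of a matrix for the power sums. -/
theorem aeval_trace_cycleMonomial {ι : Type*} [Fintype ι] [DecidableEq ι] (A : Matrix ι ι K)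
    {n : ℕ} (π : Equiv.Perm (Fin n)) :
    MvPolynomial.aeval (fun m : ℕ+ => Matrix.trace (A ^ (m : ℕ))) (cycleMonomial K π) =
      cycleSum A π := by
  rw [aeval_cycleMonomial, cycleSum_eq_prod_parts, ← map_coe_cycleLengths, Multiset.map_map]
  rfl

/-- Homogeneity of degree `n`, where the variable `X m` has degree `m`. -/
def IsHomogeneousOfWeight (q : MvPolynomial ℕ+ K) (n : ℕ) : Prop :=
  MvPolynomial.IsWeightedHomogeneous (fun m : ℕ+ => (m : ℕ)) q n

theorem weight_toFinsupp (s : Multiset ℕ+) :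
    Finsupp.weight (fun m : ℕ+ => (m : ℕ)) (Multiset.toFinsupp s) =
      (s.map fun m : ℕ+ => (m : ℕ)).sum := by
  induction s using Multiset.induction_on with
  | empty => simp
  | cons a s ih =>
    rw [Multiset.map_cons, Multiset.sum_cons, ← ih, ← Multiset.singleton_add, map_add, map_add,
      Multiset.toFinsupp_singleton, Finsupp.weight_single]
    simp

theorem isHomogeneousOfWeight_cycleMonomial {n : ℕ} (π : Equiv.Perm (Fin n)) :
    IsHomogeneousOfWeight (cycleMonomial K π) n := by
  rw [cycleMonomial_eq]
  refine MvPolynomial.isWeightedHomogeneous_monomial _ _ _ ?_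
  rw [weight_toFinsupp, map_coe_cycleLengths, π.partition.parts_sum, Fintype.card_fin]

/-! ### The scalar product with a Frobenius character -/

/-- The index set `t` may be larger than the set of parts, since parts of multiplicity zero
contribute 0! = 1. This allows 1 to be included in every case. -/
theorem zCoeff_toFinsupp (s : Multiset ℕ+) (t : Finset ℕ)
    (ht : ∀ m ∈ s, (m : ℕ) ∈ t) : zCoeff (Multiset.toFinsupp s) =
      (s.map fun m : ℕ+ => (m : ℕ)).prod *
        ∏ k ∈ t, ((s.map fun m : ℕ+ => (m : ℕ)).count k).factorial := by
  have hinj : Function.Injective fun m : ℕ+ => (m : ℕ) := PNat.coe_injective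
  rw [zCoeff, Finsupp.prod, Multiset.toFinsupp_support, Finset.prod_mul_distrib,
    Finset.prod_multiset_map_count]
  congr 1
  have h1 : (s.toFinset.map ⟨_, hinj⟩) ⊆ t := by
    intro k hk
    obtain ⟨m, hm, rfl⟩ := Finset.mem_map.1 hk
    exact ht m (Multiset.mem_toFinset.1 hm)
  rw [← Finset.prod_subset h1, Finset.prod_map]
  · refine Finset.prod_congr rfl fun m _ => ?_
    rw [Multiset.toFinsupp_apply]
    congr 1
    exact (Multiset.count_map_eq_count' _ s hinj m).symm
  · intro k _ hk
    rw [Multiset.count_eq_zero_of_notMem, Nat.factorial_zero]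
    intro hk'
    obtain ⟨m, hm, rfl⟩ := Multiset.mem_map.1 hk'
    exact hk (Finset.mem_map.2 ⟨m, Multiset.mem_toFinset.2 hm, rfl⟩)

/-- The number of permutations with given cycle lengths. -/
theorem card_cycleLengths_mul_zCoeff {n : ℕ} (s : Multiset ℕ+)
    (hs : (s.map fun m : ℕ+ => (m : ℕ)).sum = n) :
    (Finset.univ.filter fun π : Equiv.Perm (Fin n) => cycleLengths π = s).card *
      zCoeff (Multiset.toFinsupp s) = n.factorial := by
  set M := s.map fun m : ℕ+ => (m : ℕ) with hM
  set C := M.filter (2 ≤ ·) with hC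
  have hpos : ∀ k ∈ M, 0 < k := by
    intro k hk
    obtain ⟨m, -, rfl⟩ := Multiset.mem_map.1 hk
    exact m.pos
  -- The known count of permutations is by `cycleType`, which forgets fixed points; they are
  -- recovered as the parts equal to 1, numbering `n - C.sum`.
  have hMC : M = C + Multiset.replicate (M.count 1) 1 := by
    have h1 := Multiset.filter_add_not (2 ≤ ·) M
    rw [← h1, ← hC]
    congr 1
    rw [h1, ← Multiset.filter_eq']
    refine Multiset.filter_congr fun k hk => ?_
    have := hpos k hk
    omega
  have hsum : C.sum + M.count 1 = n := by
    rw [← hs]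
    conv_rhs => rw [hMC]
    simp
  have hiff : ∀ π : Equiv.Perm (Fin n), cycleLengths π = s ↔ π.cycleType = C := by
    intro π
    have hinj : Function.Injective (Multiset.map fun m : ℕ+ => (m : ℕ)) :=
      Multiset.map_injective PNat.coe_injective
    rw [← hinj.eq_iff, map_coe_cycleLengths, ← hM]
    constructor
    · intro h
      rw [hC, ← h, Equiv.Perm.filter_parts_partition_eq_cycleType]
    · intro h
      rw [Equiv.Perm.parts_partition, ← Equiv.Perm.sum_cycleType, h, Fintype.card_fin]
      conv_rhs => rw [hMC]
      congr 2
      omega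
  have hcard := Equiv.Perm.card_of_cycleType_mul_eq (Fin n) C
  rw [if_pos ⟨by rw [Fintype.card_fin]; omega, fun a ha => (Multiset.mem_filter.1 ha).2⟩,
    Fintype.card_fin] at hcard
  rw [← hcard]
  congr 1
  · congr 1
    exact Finset.filter_congr fun π _ => hiff π
  · rw [zCoeff_toFinsupp s (insert 1 C.toFinset), ← hM]
    · have h1 : 1 ∉ C.toFinset := by simp [hC]
      rw [Finset.prod_insert h1, show n - C.sum = M.count 1 by omega]
      have h2 : M.prod = C.prod := by
        conv_lhs => rw [hMC]
        simp
      have h3 : ∏ k ∈ C.toFinset, (M.count k).factorial =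
          ∏ k ∈ C.toFinset, (C.count k).factorial := by
        refine Finset.prod_congr rfl fun k hk => ?_
        rw [hC, Multiset.count_filter_of_pos]
        exact (Multiset.mem_filter.1 (Multiset.mem_toFinset.1 hk)).2
      rw [h2, h3]
      ring
    · intro m hm
      have hm' : (m : ℕ) ∈ M := Multiset.mem_map_of_mem _ hm
      have := hpos m hm'
      rw [Finset.mem_insert, Multiset.mem_toFinset, hC, Multiset.mem_filter]
      by_cases h : (m : ℕ) = 1
      · exact Or.inl h
      · exact Or.inr ⟨hm', by omega⟩

/-- The scalar product with a symmetric function of the form `(1/n!) ∑_π L(π) p_{λ(π)}`, where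
`L(π)` is the value of a linear form at the cycle monomial of `π`. -/
theorem hallInner_aeval [CharZero K] {n : ℕ} (e : MvPolynomial ℕ+ K)
    (he : IsHomogeneousOfWeight e n) (L : MvPolynomial ℕ+ K →ₗ[K] K) :
    hallInner (MvPolynomial.aeval (powerSum K) e)
      ((n.factorial : K)⁻¹ • ∑ π : Equiv.Perm (Fin n), L (cycleMonomial K π) • cyclePowerSum K π) =
      L e := by
  classical
  have hb : (n.factorial : K)⁻¹ •
      ∑ π : Equiv.Perm (Fin n), L (cycleMonomial K π) • cyclePowerSum K π =
      MvPolynomial.aeval (powerSum K) ((n.factorial : K)⁻¹ • ∑ π : Equiv.Perm (Fin n),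
        L (cycleMonomial K π) • cycleMonomial K π) := by
    simp only [map_smul, map_sum, aeval_powerSum_cycleMonomial]
  rw [hallInner, hb, powerSumExpansion_aeval, powerSumExpansion_aeval]
  conv_rhs => rw [e.as_sum, map_sum]
  refine Finset.sum_congr rfl fun m hm => ?_
  have hw := he (MvPolynomial.mem_support_iff.1 hm)
  obtain ⟨s, rfl⟩ : ∃ s, Multiset.toFinsupp s = m := ⟨_, Finsupp.toMultiset_toFinsupp m⟩
  rw [weight_toFinsupp] at hw
  have hcard := card_cycleLengths_mul_zCoeff s hw
  -- Only the permutations of cycle type `s` contribute to this coefficient, all equally; their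
  -- number times z_s is n!, which cancels the normalization.
  have hcoeff : ∀ π : Equiv.Perm (Fin n), MvPolynomial.coeff (Multiset.toFinsupp s)
      (L (cycleMonomial K π) • cycleMonomial K π) =
      if cycleLengths π = s then L (MvPolynomial.monomial (Multiset.toFinsupp s) 1) else 0 := by
    intro π
    rw [MvPolynomial.coeff_smul, cycleMonomial_eq, MvPolynomial.coeff_monomial]
    by_cases h : cycleLengths π = s
    · subst h; simp
    · rw [if_neg h, if_neg fun h' => h (Multiset.toFinsupp.injective h'), smul_zero]
  rw [MvPolynomial.coeff_smul, MvPolynomial.coeff_sum, Finset.sum_congr rfl fun π _ => hcoeff π,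
    ← Finset.sum_filter, Finset.sum_const, nsmul_eq_mul, smul_eq_mul]
  have hL : L (MvPolynomial.monomial (Multiset.toFinsupp s) (e.coeff (Multiset.toFinsupp s))) =
      e.coeff (Multiset.toFinsupp s) * L (MvPolynomial.monomial (Multiset.toFinsupp s) 1) := by
    rw [← smul_eq_mul, ← map_smul, MvPolynomial.smul_monomial, smul_eq_mul, mul_one]
  rw [hL]
  have hn : (n.factorial : K) ≠ 0 := Nat.cast_ne_zero.2 n.factorial_ne_zero
  rw [← hcard] at hn ⊢
  push_cast at hn ⊢
  have hn₁ := left_ne_zero_of_mul hn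
  have hn₂ := right_ne_zero_of_mul hn
  field_simp

/-! ### Complete homogeneous symmetric functions in terms of power sums -/

section content

variable {β : Type*} [DecidableEq β] {r : ℕ}

/-- The number of times that a function takes each of its values. -/
def content (i : Fin r → β) (x : β) : ℕ := (Finset.univ.filter fun j => i j = x).card

theorem content_comp_perm (i : Fin r → β) (τ : Equiv.Perm (Fin r)) :
    content (i ∘ τ) = content i := by
  funext x
  refine Finset.card_bij (fun j _ => τ j) (by simp) (by simp)
    fun j hj => ⟨τ.symm j, by simpa using hj⟩

theorem exists_perm_of_content_eq {i i' : Fin r → β} (h : content i = content i') :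
    ∃ τ : Equiv.Perm (Fin r), i = i' ∘ τ := by
  have e : ∀ x, {j // i j = x} ≃ {j // i' j = x} := fun x => Fintype.equivOfCardEq (by
    rw [Fintype.card_subtype, Fintype.card_subtype]
    exact congrFun h x)
  exact ⟨Equiv.ofFiberEquiv e, funext fun j => (Equiv.ofFiberEquiv_map e j).symm⟩

theorem sum_content [Fintype β] (i : Fin r → β) : ∑ x, content i x = r := by
  have := Finset.card_eq_sum_card_fiberwise (f := i) (s := Finset.univ) (t := Finset.univ)
    fun _ _ => by simp
  rw [Finset.card_univ, Fintype.card_fin] at this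
  exact this.symm

theorem exists_content_eq {n : ℕ} {d : Fin n → ℕ} (hd : ∑ x, d x = r) :
    ∃ i : Fin r → Fin n, content i = d := by
  subst hd
  refine ⟨fun j => (finSigmaFinEquiv.symm j).1, funext fun x => ?_⟩
  rw [content, ← Fintype.card_subtype, ← Fintype.card_fin (d x)]
  refine Fintype.card_congr (Equiv.trans ?_ (Equiv.sigmaSubtype (β := fun x => Fin (d x)) x))
  exact finSigmaFinEquiv.symm.subtypeEquiv fun j => Iff.rfl

/-- The stabilizers of the functions with given content have `r!` elements in total. -/
theorem sum_card_stabilizer [Fintype β] (i₀ : Fin r → β) :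
    ∑ i ∈ Finset.univ.filter (fun i : Fin r → β => content i = content i₀),
      (Finset.univ.filter fun τ : Equiv.Perm (Fin r) => i ∘ τ = i).card = r.factorial := by
  -- Orbit counting: the fibre of τ ↦ i₀ ∘ τ over a function `i` is a coset of the stabilizer of
  -- `i`, and the functions reached are those of the same content.
  have h := Finset.card_eq_sum_card_fiberwise (f := fun τ : Equiv.Perm (Fin r) => i₀ ∘ τ)
    (s := Finset.univ) (t := Finset.univ.filter fun i : Fin r → β => content i = content i₀)
    fun τ _ => by simp [content_comp_perm]
  rw [Finset.card_univ, Fintype.card_perm, Fintype.card_fin] at h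
  rw [h]
  refine Finset.sum_congr rfl fun i hi => ?_
  obtain ⟨τ₀, rfl⟩ := exists_perm_of_content_eq (Finset.mem_filter.1 hi).2
  refine Finset.card_bij (fun τ _ => τ₀ * τ) (fun τ hτ => ?_) (by simp) fun τ hτ => ?_
  · simpa [Function.comp_assoc] using hτ
  · refine ⟨τ₀⁻¹ * τ, ?_, by simp⟩
    simp only [Finset.mem_filter, Finset.mem_univ, true_and] at hτ ⊢
    funext j
    simpa using congrFun hτ j

theorem prod_eq_prod_pow_content [Fintype β] (a : β → K) (i : Fin r → β) :
    ∏ j, a (i j) = ∏ x, a x ^ content i x := by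
  rw [← Finset.prod_fiberwise_of_maps_to (g := i) (t := Finset.univ) fun _ _ => Finset.mem_univ _]
  refine Finset.prod_congr rfl fun x _ => ?_
  rw [Finset.prod_congr rfl fun j hj => by rw [(Finset.mem_filter.1 hj).2], Finset.prod_const]
  rfl

end content

theorem trace_diagonal_pow {n : ℕ} (a : Fin n → K) (m : ℕ) :
    Matrix.trace (Matrix.diagonal a ^ m) = ∑ i, a i ^ m := by
  rw [Matrix.diagonal_pow, Matrix.trace_diagonal]
  rfl

/-- Evaluation of a symmetric function, in terms of its expansion in power sums. -/
theorem evalFinHom_aeval {n : ℕ} (a : Fin n → K) (q : MvPolynomial ℕ+ K) :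
    evalFinHom a (MvPolynomial.aeval (powerSum K) q) =
      MvPolynomial.aeval (fun m : ℕ+ => Matrix.trace (Matrix.diagonal a ^ (m : ℕ))) q := by
  rw [← AlgHom.comp_apply, MvPolynomial.comp_aeval]
  simp only [evalFinHom_powerSum, trace_diagonal_pow]

theorem completeHomogeneous_eq [CharZero K] (r : ℕ) : completeHomogeneous K r =
    MvPolynomial.aeval (powerSum K)
      ((r.factorial : K)⁻¹ • ∑ τ : Equiv.Perm (Fin r), cycleMonomial K τ) := by
  classical
  refine symFun_ext fun n a => ?_
  set b : Fin n → K := fun i => (a i : K) with hb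
  have hr : (r.factorial : K) ≠ 0 := Nat.cast_ne_zero.2 r.factorial_ne_zero
  rw [← evalFinHom_apply b (MvPolynomial.aeval _ _), evalFinHom_aeval, map_smul, map_sum,
    eq_comm, smul_eq_mul, inv_mul_eq_iff_eq_mul₀ hr]
  simp only [aeval_trace_cycleMonomial, cycleSum]
  rw [Finset.sum_comm]
  -- For a diagonal matrix only the τ fixing `i` contribute, each giving the monomial of `i`.
  -- Summing over all `i` of one content then gives r! times that monomial.
  have h1 : ∀ i : Fin r → Fin n, ∑ τ : Equiv.Perm (Fin r),
      ∏ j, Matrix.diagonal b (i (τ j)) (i j) =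
      (Finset.univ.filter fun τ : Equiv.Perm (Fin r) => i ∘ τ = i).card *
        ∏ x, b x ^ content i x := by
    intro i
    rw [← prod_eq_prod_pow_content, ← nsmul_eq_mul, ← Finset.sum_const, Finset.sum_filter]
    refine Finset.sum_congr rfl fun τ _ => ?_
    split_ifs with h
    · refine Finset.prod_congr rfl fun j _ => ?_
      have hj : i (τ j) = i j := congrFun h j
      rw [hj, Matrix.diagonal_apply_eq]
    · obtain ⟨j, hj⟩ := Function.ne_iff.1 h
      exact Finset.prod_eq_zero (Finset.mem_univ j) (Matrix.diagonal_apply_ne _ hj)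
  rw [Finset.sum_congr rfl fun i _ => h1 i]
  have hdeg : ∀ d : Fin n →₀ ℕ, MvPowerSeries.coeff (d.embDomain Fin.valEmbedding)
      (completeHomogeneous K r : MvPowerSeries ℕ K) = if ∑ x, d x = r then 1 else 0 := by
    intro d
    change (if _ then _ else _ : K) = _
    rw [Finsupp.degree_apply, Finsupp.support_embDomain, Finset.sum_map]
    simp only [Finsupp.embDomain_apply_self]
    rw [Finset.sum_subset (Finset.subset_univ _) fun x _ hx => Finsupp.notMem_support_iff.1 hx]
  let D : Finset (Fin n →₀ ℕ) := Finset.finsuppAntidiag Finset.univ r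
  have hD : ∀ d : Fin n →₀ ℕ, d ∈ D ↔ ∑ x, d x = r := fun d => by
    simp [D, Finset.mem_finsuppAntidiag]
  have h2 : evalFin (completeHomogeneous K r) b = ∑ d ∈ D, ∏ x, b x ^ d x := by
    rw [evalFin, finsum_eq_sum_of_support_subset (s := D)]
    · refine Finset.sum_congr rfl fun d hd => ?_
      rw [hdeg, if_pos ((hD d).1 hd), one_mul]
    · intro d hd
      by_contra hd'
      rw [Finset.mem_coe, hD] at hd'
      rw [Function.mem_support, hdeg, if_neg hd', zero_mul] at hd
      exact hd rfl
  rw [h2, ← Finset.sum_fiberwise_of_maps_to (t := D)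
    (g := fun i : Fin r → Fin n => Finsupp.equivFunOnFinite.symm (content i)) (fun i _ => by
      rw [hD]; exact sum_content i), Finset.mul_sum]
  refine Finset.sum_congr rfl fun d hd => ?_
  obtain ⟨i₀, hi₀⟩ := exists_content_eq ((hD d).1 hd)
  have hfilt : (Finset.univ.filter fun i : Fin r → Fin n =>
      Finsupp.equivFunOnFinite.symm (content i) = d) =
      Finset.univ.filter fun i : Fin r → Fin n => content i = content i₀ := by
    refine Finset.filter_congr fun i _ => ?_
    rw [hi₀, Equiv.symm_apply_eq]
    rfl
  rw [hfilt, ← sum_card_stabilizer i₀, Nat.cast_sum, Finset.sum_mul]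
  refine Finset.sum_congr rfl fun i hi => ?_
  rw [(Finset.mem_filter.1 hi).2, hi₀]

/-! ### Polarization -/

section polarization

variable {M N : Type*} [AddCommGroup M] [Module K M] [AddCommGroup N] [Module K N] {k : ℕ}

/-- Expand the product over i of -1 + [i ∉ range f]: the subset `S` records the factors from which
-1 is taken, and a missed value makes a factor vanish. -/
theorem sum_powerset_range_subset (f : Fin k → Fin k) :
    ∑ S : Finset (Fin k), (if ∀ j, f j ∈ S then (-1 : K) ^ S.card else 0) =
      if Function.Bijective f then (-1) ^ k else 0 := by
  classical
  have h := Finset.prod_add (fun _ : Fin k => (-1 : K))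
    (fun i => if i ∈ Set.range f then (0 : K) else 1) Finset.univ
  rw [Finset.powerset_univ] at h
  refine (Finset.sum_congr rfl fun S _ => ?_).trans (h.symm.trans ?_)
  · rw [Finset.prod_const]
    split_ifs with hS
    · rw [Finset.prod_eq_one, mul_one]
      intro i hi
      rw [if_neg]
      rintro ⟨j, rfl⟩
      exact (Finset.mem_sdiff.1 hi).2 (hS j)
    · push Not at hS
      obtain ⟨j, hj⟩ := hS
      have hj' : f j ∈ Finset.univ \ S := by simpa using hj
      have h0 := Finset.prod_eq_zero (f := fun i => if i ∈ Set.range f then (0 : K) else 1) hj'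
        (if_pos (Set.mem_range_self j))
      rw [h0, mul_zero]
  · split_ifs with hf
    · rw [Finset.prod_congr rfl fun i _ => by
        rw [if_pos (Set.mem_range.2 (hf.2 i)), add_zero]]
      simp
    · rw [← Finite.surjective_iff_bijective] at hf
      simp only [Function.Surjective, not_forall] at hf
      obtain ⟨i, hi⟩ := hf
      exact Finset.prod_eq_zero (Finset.mem_univ i) (by
        rw [if_neg (by rwa [Set.mem_range])]; ring)

/-- A symmetric multilinear map in characteristic zero is determined by its restriction to the
diagonal. -/
theorem multilinearMap_ext_diagonal [CharZero K] {φ ψ : MultilinearMap K (fun _ : Fin k => M) N}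
    (hφ : ∀ (σ : Equiv.Perm (Fin k)) (x : Fin k → M), φ (fun i => x (σ i)) = φ x)
    (hψ : ∀ (σ : Equiv.Perm (Fin k)) (x : Fin k → M), ψ (fun i => x (σ i)) = ψ x)
    (h : ∀ x, (φ fun _ => x) = ψ fun _ => x) : φ = ψ := by
  classical
  ext x
  rw [← sub_eq_zero, ← sub_apply]
  set θ := φ - ψ with hθ
  have hsymm : ∀ (σ : Equiv.Perm (Fin k)) (x : Fin k → M), θ (fun i => x (σ i)) = θ x := by
    intro σ x
    rw [hθ, sub_apply, sub_apply, hφ, hψ]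
  have hdiag : ∀ x, (θ fun _ => x) = 0 := by
    intro x
    rw [hθ, sub_apply, h, sub_self]
  -- The polarization identity: evaluate θ on the diagonal at Σ_{i ∈ S} x_i and take the alternating
  -- sum over `S`. Only bijective index functions survive, leaving ± k! θ(x).
  have h1 : ∀ S : Finset (Fin k),
      ∑ f : Fin k → Fin k, (if ∀ j, f j ∈ S then (-1 : K) ^ S.card else 0) • θ (fun i => x (f i)) =
        0 := by
    intro S
    have h2 := θ.map_sum_finset (fun _ i => x i) fun _ => S
    rw [hdiag] at h2
    simp only [ite_smul, zero_smul]
    rw [← Finset.sum_filter, ← Finset.smul_sum]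
    have h3 : (Finset.univ.filter fun f : Fin k → Fin k => ∀ j, f j ∈ S) =
        Fintype.piFinset fun _ => S := by
      ext f; simp
    rw [h3, ← h2, smul_zero]
  have h4 : ∑ S : Finset (Fin k), ∑ f : Fin k → Fin k,
      (if ∀ j, f j ∈ S then (-1 : K) ^ S.card else 0) • θ (fun i => x (f i)) = 0 :=
    Finset.sum_eq_zero fun S _ => h1 S
  rw [Finset.sum_comm] at h4
  simp only [← Finset.sum_smul, sum_powerset_range_subset] at h4
  simp only [ite_smul, zero_smul] at h4
  rw [← Finset.sum_filter, ← Finset.smul_sum] at h4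
  have h5 : ∑ f ∈ Finset.univ.filter (fun f : Fin k → Fin k => Function.Bijective f),
      θ (fun i => x (f i)) = ∑ σ : Equiv.Perm (Fin k), θ fun i => x (σ i) := by
    refine (Finset.sum_bij (fun (σ : Equiv.Perm (Fin k)) _ => (σ : Fin k → Fin k)) ?_ ?_ ?_ ?_).symm
    · intro σ _
      exact Finset.mem_filter.2 ⟨Finset.mem_univ _, σ.bijective⟩
    · intro σ _ τ _ h
      exact Equiv.coe_fn_injective h
    · intro f hf
      exact ⟨Equiv.ofBijective f (Finset.mem_filter.1 hf).2, Finset.mem_univ _, rfl⟩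
    · intro σ _
      rfl
  rw [h5, Finset.sum_congr rfl fun σ _ => hsymm σ x, Finset.sum_const, Finset.card_univ,
    Fintype.card_perm, Fintype.card_fin, ← Nat.cast_smul_eq_nsmul K, smul_smul] at h4
  exact (smul_eq_zero.1 h4).resolve_left (mul_ne_zero (pow_ne_zero _ (by simp))
    (Nat.cast_ne_zero.2 k.factorial_ne_zero))

/-- The symmetrization of a multilinear map. -/
def symmetrize (φ : MultilinearMap K (fun _ : Fin k => M) N) :
    MultilinearMap K (fun _ : Fin k => M) N :=
  (k.factorial : K)⁻¹ • ∑ σ : Equiv.Perm (Fin k), φ.domDomCongr σ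

theorem symmetrize_apply (φ : MultilinearMap K (fun _ : Fin k => M) N) (x : Fin k → M) :
    symmetrize φ x = (k.factorial : K)⁻¹ • ∑ σ : Equiv.Perm (Fin k), φ fun i => x (σ i) := by
  simp [symmetrize]

theorem symmetrize_perm (φ : MultilinearMap K (fun _ : Fin k => M) N) (τ : Equiv.Perm (Fin k))
    (x : Fin k → M) : symmetrize φ (fun i => x (τ i)) = symmetrize φ x := by
  rw [symmetrize_apply, symmetrize_apply, ← Equiv.sum_comp (Equiv.mulLeft τ⁻¹)]
  simp

theorem inv_factorial_smul_sum_const [CharZero K] (k : ℕ) (y : N) :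
    (k.factorial : K)⁻¹ • ∑ _σ : Equiv.Perm (Fin k), y = y := by
  rw [Finset.sum_const, Finset.card_univ, Fintype.card_perm, Fintype.card_fin,
    ← Nat.cast_smul_eq_nsmul K, smul_smul,
    inv_mul_cancel₀ (Nat.cast_ne_zero.2 k.factorial_ne_zero), one_smul]

theorem symmetrize_diagonal [CharZero K] (φ : MultilinearMap K (fun _ : Fin k => M) N) (x : M) :
    (symmetrize φ fun _ => x) = φ fun _ => x := by
  rw [symmetrize_apply, inv_factorial_smul_sum_const]

end polarization

/-! ### Polynomial functors -/

section functor

variable {k : ℕ} {P : FGModuleCat.{u} K ⥤ FGModuleCat.{u} K}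

theorem functorMap_comp (P : FGModuleCat.{u} K ⥤ FGModuleCat.{u} K) {U W Z : Type u}
    [AddCommGroup U] [Module K U] [Module.Finite K U] [AddCommGroup W] [Module K W]
    [Module.Finite K W] [AddCommGroup Z] [Module K Z] [Module.Finite K Z]
    (g : W →ₗ[K] Z) (f : U →ₗ[K] W) :
    functorMap P (g ∘ₗ f) = functorMap P g ∘ₗ functorMap P f := by
  have h : FGModuleCat.ofHom (g ∘ₗ f) = FGModuleCat.ofHom f ≫ FGModuleCat.ofHom g := rfl
  unfold functorMap
  rw [h, P.map_comp]
  rfl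

theorem functorMap_pow (P : FGModuleCat.{u} K ⥤ FGModuleCat.{u} K) {V : Type u}
    [AddCommGroup V] [Module K V] [Module.Finite K V] (A : V →ₗ[K] V) (m : ℕ) :
    functorMap P (A ^ m) = functorMap P A ^ m := by
  induction m with
  | zero =>
    have h : FGModuleCat.ofHom (1 : V →ₗ[K] V) = 𝟙 (FGModuleCat.of K V) := rfl
    rw [pow_zero, pow_zero]
    unfold functorMap
    rw [h, P.map_id]
    rfl
  | succ m ih => rw [pow_succ, pow_succ, ← ih]; exact functorMap_comp P (A ^ m) A

variable (hP : IsHomogeneousPolynomialFunctor k P)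

/-- The symmetric multilinear map whose restriction to the diagonal is `f ↦ P(f)`. -/
def polar (U W : Type u) [AddCommGroup U] [Module K U] [Module.Finite K U] [AddCommGroup W]
    [Module K W] [Module.Finite K W] : MultilinearMap K (fun _ : Fin k => U →ₗ[K] W)
      (P.obj (FGModuleCat.of K U) →ₗ[K] P.obj (FGModuleCat.of K W)) :=
  symmetrize (hP U W).choose

variable {U W Z : Type u} [AddCommGroup U] [Module K U] [Module.Finite K U] [AddCommGroup W]
  [Module K W] [Module.Finite K W] [AddCommGroup Z] [Module K Z] [Module.Finite K Z]

theorem polar_diagonal [CharZero K] (f : U →ₗ[K] W) :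
    (polar hP U W fun _ => f) = functorMap P f := by
  rw [polar, symmetrize_diagonal]
  exact ((hP U W).choose_spec f).symm

theorem polar_perm (σ : Equiv.Perm (Fin k)) (a : Fin k → U →ₗ[K] W) :
    polar hP U W (fun i => a (σ i)) = polar hP U W a :=
  symmetrize_perm _ _ _

/-- Both sides are symmetric and multilinear in `a`, and agree on the diagonal by functoriality. -/
theorem polar_comp_functorMap [CharZero K] (a : Fin k → W →ₗ[K] Z) (b : U →ₗ[K] W) :
    polar hP W Z a ∘ₗ functorMap P b = polar hP U Z fun i => a i ∘ₗ b := by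
  have h : (LinearMap.lcomp K _ (functorMap P b)).compMultilinearMap (polar hP W Z) =
      (polar hP U Z).compLinearMap fun _ => LinearMap.lcomp K Z b := by
    refine multilinearMap_ext_diagonal (fun σ x => ?_) (fun σ x => ?_) fun x => ?_
    · rw [LinearMap.compMultilinearMap_apply, polar_perm]
      rfl
    · rw [MultilinearMap.compLinearMap_apply]
      exact polar_perm hP σ fun i => LinearMap.lcomp K Z b (x i)
    · rw [LinearMap.compMultilinearMap_apply, MultilinearMap.compLinearMap_apply, polar_diagonal,
        polar_diagonal]
      exact (functorMap_comp P x b).symm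
  exact congrArg (fun φ => φ a) h

/-- Polarization of `polar_comp_functorMap` in `b`. The average over σ is needed because the family
a_i ∘ b_i is not symmetric in `b` alone. -/
theorem polar_comp_polar [CharZero K] (a : Fin k → W →ₗ[K] Z) (b : Fin k → U →ₗ[K] W) :
    polar hP W Z a ∘ₗ polar hP U W b =
      (k.factorial : K)⁻¹ • ∑ σ : Equiv.Perm (Fin k), polar hP U Z fun i => a i ∘ₗ b (σ i) := by
  have h : (LinearMap.llcomp K _ _ _ (polar hP W Z a)).compMultilinearMap (polar hP U W) =
      symmetrize ((polar hP U Z).compLinearMap fun i => LinearMap.llcomp K U W Z (a i)) := by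
    refine multilinearMap_ext_diagonal (fun σ x => ?_) (fun σ x => symmetrize_perm _ _ _)
      fun x => ?_
    · rw [LinearMap.compMultilinearMap_apply, polar_perm]
      rfl
    · rw [LinearMap.compMultilinearMap_apply, symmetrize_diagonal,
        MultilinearMap.compLinearMap_apply, polar_diagonal]
      exact polar_comp_functorMap hP a x
  have h' := congrArg (fun φ => φ b) h
  simp only [symmetrize_apply] at h'
  exact h'

/-- The trace of the operator on `P(K^k)` given by the permutation `σ` on the multilinear part. -/
def permTrace (σ : Equiv.Perm (Fin k)) : K :=
  LinearMap.trace K _ (polar hP (Fin k → K) (Fin k → K) fun i =>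
    (LinearMap.proj (σ i) : (Fin k → K) →ₗ[K] K).smulRight (Pi.single i (1 : K)))

/-- The rank one operators factor as a_i ∘ b_i through K^k, with a_i ∘ b_j = 0 for i ≠ j. So
composing the polarizations one way leaves only σ = 1, the operator on W. The other way gives
operators on P(K^k) that depend on W only through the scalars ξ_i(v_{σ i}). The trace does not see
the order. -/
theorem trace_polar_smulRight [CharZero K] (ξ : Fin k → Module.Dual K W) (v : Fin k → W) :
    LinearMap.trace K _ (polar hP W W fun i => (ξ i).smulRight (v i)) =
      ∑ σ : Equiv.Perm (Fin k), (∏ i, ξ i (v (σ i))) * permTrace hP σ := by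
  classical
  let a : Fin k → (Fin k → K) →ₗ[K] W := fun i =>
    (LinearMap.proj i : (Fin k → K) →ₗ[K] K).smulRight (v i)
  let b : Fin k → W →ₗ[K] (Fin k → K) := fun i => (ξ i).smulRight (Pi.single i (1 : K))
  have hab : ∀ i j, a i ∘ₗ b j = if i = j then (ξ i).smulRight (v i) else 0 := by
    intro i j
    split_ifs with h
    · subst h
      ext x
      simp [a, b]
    · ext x
      simp [a, b, Pi.single_eq_of_ne h]
  have hba : ∀ i j, b i ∘ₗ a j = ξ i (v j) •
      (LinearMap.proj j : (Fin k → K) →ₗ[K] K).smulRight (Pi.single i (1 : K)) := by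
    intro i j
    refine LinearMap.ext fun x => ?_
    simp [a, b, smul_smul, mul_comm]
  have hfac : (k.factorial : K) ≠ 0 := Nat.cast_ne_zero.2 k.factorial_ne_zero
  have h1 := polar_comp_polar hP a b
  rw [Finset.sum_eq_single (1 : Equiv.Perm (Fin k))] at h1
  rotate_left
  · intro σ _ hσ
    obtain ⟨i, hi⟩ : ∃ i, σ i ≠ i := by
      by_contra h
      push Not at h
      exact hσ (Equiv.ext h)
    exact MultilinearMap.map_coord_zero _ i (by rw [hab, if_neg hi.symm])
  · simp
  have h2 := polar_comp_polar hP b a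
  have h3 := LinearMap.trace_comp_comm' (polar hP (Fin k → K) W a) (polar hP W (Fin k → K) b)
  rw [h1, h2, map_smul, map_smul] at h3
  have h4 := smul_right_injective _ (inv_ne_zero hfac) h3
  simp only [hab, hba, Equiv.Perm.one_apply, if_true] at h4
  rw [← h4, map_sum]
  refine Finset.sum_congr rfl fun σ _ => ?_
  rw [MultilinearMap.map_smul_univ, map_smul, smul_eq_mul]
  rfl

/-- The substitution of the traces of the powers of an endomorphism for the power sums. -/
def traceEval {V : Type*} [AddCommGroup V] [Module K V] (A : V →ₗ[K] V) :
    MvPolynomial ℕ+ K →ₐ[K] K :=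
  MvPolynomial.aeval fun m : ℕ+ => LinearMap.trace K V (A ^ (m : ℕ))

theorem traceEval_eq_matrix {ι V : Type*} [Fintype ι] [DecidableEq ι] [AddCommGroup V] [Module K V]
    (b : Module.Basis ι K V) (A : V →ₗ[K] V) : traceEval A =
      MvPolynomial.aeval fun m : ℕ+ => Matrix.trace (LinearMap.toMatrix b b A ^ (m : ℕ)) := by
  simp only [traceEval, LinearMap.trace_eq_matrix_trace K b, LinearMap.toMatrix_pow]

theorem traceEval_cycleMonomial {ι V : Type*} [Fintype ι] [DecidableEq ι] [AddCommGroup V]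
    [Module K V] (b : Module.Basis ι K V) (A : V →ₗ[K] V) {n : ℕ} (π : Equiv.Perm (Fin n)) :
    traceEval A (cycleMonomial K π) = cycleSum (LinearMap.toMatrix b b A) π := by
  rw [traceEval_eq_matrix b, aeval_trace_cycleMonomial]

/-- An endomorphism is the combination of the matrix units with its matrix entries. -/
theorem eq_sum_smulRight {ι V : Type*} [Fintype ι] [DecidableEq ι] [AddCommGroup V] [Module K V]
    (b : Module.Basis ι K V) (A : V →ₗ[K] V) : A = ∑ p : ι × ι,
      LinearMap.toMatrix b b A p.1 p.2 • (b.coord p.2).smulRight (b p.1) := by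
  refine b.ext fun y => ?_
  rw [LinearMap.sum_apply, Fintype.sum_prod_type, Finset.sum_comm, Finset.sum_eq_single y]
  · simp only [LinearMap.smul_apply, LinearMap.smulRight_apply, Module.Basis.coord_apply,
      Module.Basis.repr_self, Finsupp.single_eq_same, one_smul, LinearMap.toMatrix_apply]
    exact (b.sum_repr (A (b y))).symm
  · intro z _ hz
    refine Finset.sum_eq_zero fun x _ => ?_
    simp [Finsupp.single_eq_of_ne hz]
  · simp

/-- The expansion in power sums of the character of a polynomial functor. -/
def characterExpansion : MvPolynomial ℕ+ K :=
  ∑ σ : Equiv.Perm (Fin k), permTrace hP σ • cycleMonomial K σ⁻¹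

theorem isHomogeneousOfWeight_characterExpansion :
    IsHomogeneousOfWeight (characterExpansion hP) k := by
  refine MvPolynomial.IsWeightedHomogeneous.sum _ _ _ fun σ _ => ?_
  rw [MvPolynomial.smul_eq_C_mul]
  exact (isHomogeneousOfWeight_cycleMonomial _).C_mul _

/-- The trace of `P(A)` for an arbitrary endomorphism `A`. -/
theorem trace_functorMap [CharZero K] (A : W →ₗ[K] W) :
    LinearMap.trace K _ (functorMap P A) = traceEval A (characterExpansion hP) := by
  classical
  let b := Module.Free.chooseBasis K W
  set M := LinearMap.toMatrix b b A with hM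
  have hA := eq_sum_smulRight b A
  rw [← hM] at hA
  conv_lhs => rw [← polar_diagonal hP, hA]
  rw [MultilinearMap.map_sum, map_sum, characterExpansion, map_sum]
  simp only [MultilinearMap.map_smul_univ, map_smul, trace_polar_smulRight,
    traceEval_cycleMonomial b, ← hM, smul_eq_mul, Finset.mul_sum]
  rw [Finset.sum_comm]
  refine Finset.sum_congr rfl fun σ _ => ?_
  rw [← (Equiv.arrowProdEquivProdArrow _ _ _).symm.sum_comp, Fintype.sum_prod_type, cycleSum,
    Finset.mul_sum]
  refine Finset.sum_congr rfl fun x _ => ?_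
  -- The pairing of dual basis vectors forces y = x ∘ σ. What remains is the product of the entries
  -- at (x i, x (σ i)), the cycle sum of σ⁻¹; hence the inverse in `characterExpansion`.
  rw [Finset.sum_eq_single fun i => x (σ i)]
  · rw [← Equiv.prod_comp σ fun j => LinearMap.toMatrix b b A (x (σ⁻¹ j)) (x j)]
    simp [Equiv.arrowProdEquivProdArrow, mul_comm, hM]
  · intro y _ hy
    obtain ⟨i, hi⟩ := Function.ne_iff.1 hy
    rw [Finset.prod_eq_zero (f := fun i => b.coord _ _) (Finset.mem_univ i), zero_mul, mul_zero]
    simp [Equiv.arrowProdEquivProdArrow, Finsupp.single_eq_of_ne hi]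
  · simp

theorem isCharacter_characterExpansion [CharZero K] :
    IsCharacter P (MvPolynomial.aeval (powerSum K) (characterExpansion hP)) := by
  intro n a
  rw [← evalFinHom_apply, evalFinHom_aeval, trace_functorMap hP,
    traceEval_eq_matrix (Pi.basisFun K (Fin n))]
  simp only [LinearMap.toMatrix_eq_toMatrix', LinearMap.toMatrix'_toLin']

theorem IsCharacter.unique [CharZero K] {F F' : SymFun K} (hF : IsCharacter P F)
    (hF' : IsCharacter P F') : F = F' :=
  symFun_ext fun n a => (hF n a).trans (hF' n a).symm

theorem character_eq [CharZero K] :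
    character P = MvPolynomial.aeval (powerSum K) (characterExpansion hP) :=
  (Classical.epsilon_spec ⟨_, isCharacter_characterExpansion hP⟩ : IsCharacter P _).unique
    (isCharacter_characterExpansion hP)

/-- The expansion in power sums of `h_r[ch P]`. -/
def plethysmExpansion (r : ℕ) : MvPolynomial ℕ+ K :=
  MvPolynomial.aeval (fun n => MvPolynomial.aeval
    (fun m => (MvPolynomial.X (n * m) : MvPolynomial ℕ+ K)) (characterExpansion hP))
    ((r.factorial : K)⁻¹ • ∑ τ : Equiv.Perm (Fin r), cycleMonomial K τ)

theorem plethysm_completeHomogeneous_character [CharZero K] (r : ℕ) :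
    plethysm (completeHomogeneous K r) (character P) =
      MvPolynomial.aeval (powerSum K) (plethysmExpansion hP r) := by
  rw [completeHomogeneous_eq, character_eq hP, plethysm_aeval]
  rfl

/-- The value of the expansion of `h_r[ch P]` at an endomorphism is computed by the traces of the
powers of `P(A)`. -/
theorem traceEval_plethysmExpansion [CharZero K] (r : ℕ) (A : W →ₗ[K] W) :
    traceEval A (plethysmExpansion hP r) = (r.factorial : K)⁻¹ *
      ∑ τ : Equiv.Perm (Fin r), traceEval (functorMap P A) (cycleMonomial K τ) := by
  rw [plethysmExpansion, ← AlgHom.comp_apply, MvPolynomial.comp_aeval, map_smul, map_sum,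
    smul_eq_mul]
  congr 1
  refine Finset.sum_congr rfl fun τ _ => ?_
  rw [traceEval]
  congr 2
  funext n
  -- Since P(A)^n = P(A^n), its trace is the character at A^n, where p_m takes the value Tr A^{nm};
  -- this is the substitution p_m ↦ p_{nm} of plethysm.
  rw [← AlgHom.comp_apply, MvPolynomial.comp_aeval, ← functorMap_pow, trace_functorMap hP]
  unfold traceEval
  congr 2
  funext m
  simp [pow_mul]

/-- This supplies the degree required by `hallInner_aeval`: `X n`, of weight n, is replaced by a
polynomial of weight n k. -/
theorem isHomogeneousOfWeight_plethysmExpansion (r : ℕ) :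
    IsHomogeneousOfWeight (plethysmExpansion hP r) (r * k) := by
  have hX : ∀ n : ℕ+, IsHomogeneousOfWeight (MvPolynomial.aeval
      (fun m => (MvPolynomial.X (n * m) : MvPolynomial ℕ+ K)) (characterExpansion hP)) (n * k) := by
    intro n
    rw [MvPolynomial.aeval_def, MvPolynomial.eval₂_eq]
    refine MvPolynomial.IsWeightedHomogeneous.sum _ _ _ fun d hd => ?_
    have hw := isHomogeneousOfWeight_characterExpansion hP (MvPolynomial.mem_support_iff.1 hd)
    refine MvPolynomial.IsWeightedHomogeneous.C_mul ?_ _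
    have h := MvPolynomial.IsWeightedHomogeneous.prod d.support
      (fun i => (MvPolynomial.X (n * i) : MvPolynomial ℕ+ K) ^ d i)
      (fun i => d i • ((n * i : ℕ+) : ℕ)) (w := fun m : ℕ+ => (m : ℕ))
      fun i _ => (MvPolynomial.isWeightedHomogeneous_X K _ _).pow _
    rw [← hw, Finsupp.weight_apply, Finsupp.sum, Finset.mul_sum]
    convert h using 2
    simp only [PNat.mul_coe, smul_eq_mul]
    ring
  rw [plethysmExpansion, map_smul, map_sum, MvPolynomial.smul_eq_C_mul]
  refine MvPolynomial.IsWeightedHomogeneous.C_mul ?_ _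
  refine MvPolynomial.IsWeightedHomogeneous.sum _ _ _ fun τ _ => ?_
  rw [aeval_cycleMonomial]
  have hsum : r * k = ((cycleLengths τ).map fun m : ℕ+ => (m : ℕ) * k).sum := by
    rw [Multiset.sum_map_mul_right, map_coe_cycleLengths, τ.partition.parts_sum, Fintype.card_fin]
  rw [hsum]
  induction cycleLengths τ using Multiset.induction_on with
  | empty => simpa using MvPolynomial.isWeightedHomogeneous_one K _
  | cons n s ih =>
    rw [Multiset.map_cons, Multiset.prod_cons, Multiset.map_cons, Multiset.sum_cons]
    exact (hX n).mul ih

end functor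

/-! ### Regular maps -/

section regular

variable {G : Type v} [Group G] [AffineAlgebraicGroup K G]

/-- A map from an algebraic group to a vector space is regular if its composition with each linear
form is regular. -/
def IsRegularMap {N : Type*} [AddCommGroup N] [Module K N] (f : G → N) : Prop :=
  ∀ ψ : Module.Dual K N, (fun g => ψ (f g)) ∈ AffineAlgebraicGroup.regular (K := K) (G := G)

variable {N N' : Type*} [AddCommGroup N] [Module K N] [AddCommGroup N'] [Module K N']

theorem IsRegularMap.linear {f : G → N} (hf : IsRegularMap (K := K) f) (L : N →ₗ[K] N') :
    IsRegularMap (K := K) fun g => L (f g) :=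
  fun ψ => hf (ψ ∘ₗ L)

theorem isRegularMap_const (y : N) : IsRegularMap (K := K) fun _ : G => y := fun ψ =>
  (AffineAlgebraicGroup.regular (K := K) (G := G)).algebraMap_mem (ψ y)

theorem IsRegularMap.prodMk {f : G → N} {f' : G → N'} (hf : IsRegularMap (K := K) f)
    (hf' : IsRegularMap (K := K) f') : IsRegularMap (K := K) fun g => (f g, f' g) := by
  intro ψ
  have h : (fun g => ψ (f g, f' g)) =
      (fun g => (ψ ∘ₗ LinearMap.inl K N N') (f g)) +
        fun g => (ψ ∘ₗ LinearMap.inr K N N') (f' g) := by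
    funext g
    simp [← map_add]
  rw [h]
  exact add_mem (hf _) (hf' _)

theorem IsRegularMap.inv {f : G → N} (hf : IsRegularMap (K := K) f) :
    IsRegularMap (K := K) fun g => f g⁻¹ :=
  fun ψ => AffineAlgebraicGroup.regular_inv _ (hf ψ)

/-- In coordinates the map is a polynomial in regular functions. This covers both tensor powers and
polynomial functors. -/
theorem IsRegularMap.multilinear [FiniteDimensional K N] {f : G → N}
    (hf : IsRegularMap (K := K) f) {k : ℕ} (φ : MultilinearMap K (fun _ : Fin k => N) N') :
    IsRegularMap (K := K) fun g => φ fun _ => f g := by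
  classical
  intro ψ
  let b := Module.Free.chooseBasis K N
  have h : (fun g => ψ (φ fun _ => f g)) = ∑ i : Fin k → Module.Free.ChooseBasisIndex K N,
      ψ (φ fun j => b (i j)) • ∏ j, fun g => b.coord (i j) (f g) := by
    funext g
    conv_lhs => rw [← b.sum_repr (f g), MultilinearMap.map_sum, map_sum]
    rw [Finset.sum_apply]
    refine Finset.sum_congr rfl fun i _ => ?_
    rw [MultilinearMap.map_smul_univ, map_smul, Pi.smul_apply, Finset.prod_apply, smul_eq_mul,
      smul_eq_mul, mul_comm]
    rfl
  rw [h]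
  exact sum_mem fun i _ => Subalgebra.smul_mem _ (prod_mem fun j _ => hf _) _

theorem IsRegularMap.isRational {ρ : Representation K G N}
    (h : IsRegularMap (K := K) fun g => ρ g) : IsRational ρ :=
  fun w φ => h (φ ∘ₗ LinearMap.applyₗ w)

theorem IsRational.isRegularMap [FiniteDimensional K N] {ρ : Representation K G N}
    (h : IsRational ρ) : IsRegularMap (K := K) fun g => ρ g := by
  classical
  intro ψ
  let b := Module.Free.chooseBasis K N
  have h' : (fun g => ψ (ρ g)) = ∑ p : _ × _, ψ ((b.coord p.2).smulRight (b p.1)) •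
      fun g => b.coord p.1 (ρ g (b p.2)) := by
    funext g
    conv_lhs => rw [eq_sum_smulRight b (ρ g), map_sum]
    rw [Finset.sum_apply]
    refine Finset.sum_congr rfl fun p _ => ?_
    rw [map_smul, Pi.smul_apply, smul_eq_mul, smul_eq_mul, mul_comm, LinearMap.toMatrix_apply]
    rfl
  rw [h']
  exact sum_mem fun p _ => Subalgebra.smul_mem _ (h _ _) _

end regular

/-! ### Reynolds operators -/

section reynolds

variable {G : Type v} [Group G] {W : Type*} [AddCommGroup W] [Module K W]

/-- The operator by which an element of the group algebra acts. -/
def average (ρ : Representation K G W) (c : G →₀ K) : W →ₗ[K] W :=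
  Finsupp.linearCombination K (fun g => ρ g) c

/-- An element of the group algebra, with sum of coefficients one, acts as a projection onto the
invariants. -/
structure IsReynolds (ρ : Representation K G W) (c : G →₀ K) : Prop where
  sum_eq_one : Finsupp.linearCombination K (fun _ => (1 : K)) c = 1
  comp_average : ∀ g, ρ g ∘ₗ average ρ c = average ρ c

/-- Because the average is a finite combination of group elements, any linear functional of
operators can be averaged termwise, with coefficients independent of the representation. -/
theorem map_average {N : Type*} [AddCommGroup N] [Module K N] (ρ : Representation K G W)
    (c : G →₀ K) (L : (W →ₗ[K] W) →ₗ[K] N) :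
    L (average ρ c) = Finsupp.linearCombination K (fun g => L (ρ g)) c := by
  rw [average, Finsupp.apply_linearCombination]
  rfl

theorem IsReynolds.linearCombination_const {N : Type*} [AddCommGroup N] [Module K N]
    {ρ : Representation K G W} {c : G →₀ K} (h : IsReynolds ρ c) (y : N) :
    Finsupp.linearCombination K (fun _ : G => y) c = y := by
  have h1 := congrArg (LinearMap.toSpanSingleton K N y) h.sum_eq_one
  rw [Finsupp.apply_linearCombination] at h1
  have h2 : (LinearMap.toSpanSingleton K N y ∘ fun _ : G => (1 : K)) = fun _ => y := by
    funext g; simp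
  rw [h2] at h1
  simpa using h1

theorem IsReynolds.isProj {ρ : Representation K G W} {c : G →₀ K} (h : IsReynolds ρ c) :
    LinearMap.IsProj ρ.invariants (average ρ c) where
  map_mem w g := congrArg (fun f => f w) (h.comp_average g)
  map_id w hw := by
    have h1 := map_average ρ c (LinearMap.applyₗ w)
    have h2 : (fun g => LinearMap.applyₗ w (ρ g)) = fun _ : G => w := funext fun g => hw g
    rw [h2, h.linearCombination_const] at h1
    exact h1

/-- The trace of an operator restricted to the image of a projection. -/
theorem trace_restrict_of_isProj [FiniteDimensional K W] {p : Submodule K W} {e : W →ₗ[K] W}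
    (he : LinearMap.IsProj p e) (f : W →ₗ[K] W) (f' : p →ₗ[K] p)
    (hf : ∀ x, (f' x : W) = f x) :
    LinearMap.trace K p f' = LinearMap.trace K W (f ∘ₗ e) := by
  have h1 : f ∘ₗ e = p.subtype ∘ₗ (f' ∘ₗ he.codRestrict) := by
    refine LinearMap.ext fun x => ?_
    simp [hf]
  have h2 : f' = (f' ∘ₗ he.codRestrict) ∘ₗ p.subtype := by
    refine LinearMap.ext fun x => ?_
    have : he.codRestrict (x : W) = x := he.codRestrict_apply_cod x
    simp [this]
  rw [h1, LinearMap.trace_comp_comm' (f' ∘ₗ he.codRestrict) p.subtype, ← h2]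

theorem IsReynolds.finrank_invariants [FiniteDimensional K W] {ρ : Representation K G W}
    {c : G →₀ K} (h : IsReynolds ρ c) :
    (Module.finrank K ρ.invariants : K) = LinearMap.trace K W (average ρ c) :=
  h.isProj.trace.symm

/-- If the Reynolds operators exist, the invariants in a representation and in its dual have the
same dimension. -/
theorem finrank_invariants_dual [FiniteDimensional K W] {ρ : Representation K G W}
    {c c' : G →₀ K} (h : IsReynolds ρ c) (h' : IsReynolds ρ.dual c') :
    Module.finrank K ρ.dual.invariants = Module.finrank K ρ.invariants := by
  apply le_antisymm
  · rw [← Subspace.dual_finrank_eq (K := K) (V := ρ.invariants)]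
    -- Restricting invariant forms to invariant vectors is injective: an invariant φ satisfies φ ∘ R
    -- = φ for the Reynolds operator R. The reverse inequality evaluates invariant forms at
    -- invariant vectors, using the Reynolds operator of the dual.
    refine LinearMap.finrank_le_finrank_of_injective
      (f := (Module.Dual.transpose ρ.invariants.subtype) ∘ₗ ρ.dual.invariants.subtype) ?_
    rw [injective_iff_map_eq_zero]
    rintro ⟨φ, hφ⟩ h0
    refine Subtype.ext (LinearMap.ext fun w => ?_)
    have h1 : φ (average ρ c w) = 0 :=
      congrArg (fun f => f ⟨average ρ c w, h.isProj.map_mem w⟩) h0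
    have h2 := map_average ρ c (φ ∘ₗ LinearMap.applyₗ w)
    have h3 : (fun g => (φ ∘ₗ LinearMap.applyₗ w) (ρ g)) = fun _ : G => φ w := by
      funext g
      have := congrArg (fun f => f w) (hφ g⁻¹)
      simpa [Representation.dual_apply, Module.Dual.transpose_apply] using this
    rw [h3, h.linearCombination_const] at h2
    exact h2.symm.trans h1
  · rw [← Subspace.dual_finrank_eq (K := K) (V := ρ.dual.invariants)]
    refine LinearMap.finrank_le_finrank_of_injective
      (f := (Module.Dual.transpose ρ.dual.invariants.subtype) ∘ₗ Module.Dual.eval K W ∘ₗ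
        ρ.invariants.subtype) ?_
    rw [injective_iff_map_eq_zero]
    rintro ⟨w, hw⟩ h0
    refine Subtype.ext ((Module.forall_dual_apply_eq_zero_iff K w).1 fun φ => ?_)
    have h1 : average ρ.dual c' φ w = 0 :=
      congrArg (fun f => f ⟨average ρ.dual c' φ, h'.isProj.map_mem φ⟩) h0
    have h2 := map_average ρ.dual c' (LinearMap.applyₗ w ∘ₗ LinearMap.applyₗ φ)
    have h3 : (fun g => (LinearMap.applyₗ w ∘ₗ LinearMap.applyₗ φ) (ρ.dual g)) =
        fun _ : G => φ w := by
      funext g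
      have := hw g⁻¹
      simp [Representation.dual_apply, Module.Dual.transpose_apply, this]
    rw [h3, h'.linearCombination_const] at h2
    exact h2.symm.trans h1

/-- This permits averaging over two representations with the same coefficients. -/
theorem IsReynolds.of_prod {W' : Type*} [AddCommGroup W'] [Module K W']
    {ρ : Representation K G W} {ρ' : Representation K G W'} {c : G →₀ K}
    (h : IsReynolds (ρ.prod ρ') c) : IsReynolds ρ c ∧ IsReynolds ρ' c := by
  have h1 : ∀ w, average (ρ.prod ρ') c w = (average ρ c w.1, average ρ' c w.2) := by
    intro w
    simp only [average, Finsupp.linearCombination_apply, Finsupp.sum, LinearMap.sum_apply,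
      LinearMap.smul_apply]
    refine Prod.ext ?_ ?_
    · rw [Prod.fst_sum]; rfl
    · rw [Prod.snd_sum]; rfl
  have h2 : ∀ g w, ρ.prod ρ' g (average (ρ.prod ρ') c w) = average (ρ.prod ρ') c w :=
    fun g w => congrArg (fun f => f w) (h.comp_average g)
  simp only [h1] at h2
  exact ⟨⟨h.sum_eq_one, fun g => LinearMap.ext fun w => congrArg Prod.fst (h2 g (w, 0))⟩,
    ⟨h.sum_eq_one, fun g => LinearMap.ext fun w => congrArg Prod.snd (h2 g (0, w))⟩⟩

/-- The Reynolds operator of the product with a finite group. -/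
theorem IsReynolds.exists_prod_finite [CharZero K] {F : Type*} [Group F] [Fintype F]
    {ρ : Representation K (F × G) W} {c : G →₀ K}
    (h : IsReynolds (ρ.comp (MonoidHom.inr F G)) c) :
    ∃ c' : F × G →₀ K, IsReynolds ρ c' ∧ average ρ c' = ((Fintype.card F : K)⁻¹ •
      ∑ x : F, ρ (x, 1)) ∘ₗ average (ρ.comp (MonoidHom.inr F G)) c := by
  have hF : (Fintype.card F : K) ≠ 0 := Nat.cast_ne_zero.2 Fintype.card_ne_zero
  set R := average (ρ.comp (MonoidHom.inr F G)) c
  -- The product of the uniform average over `F` with `c`.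
  let c' : F × G →₀ K := (Fintype.card F : K)⁻¹ • ∑ x : F, c.mapDomain (Prod.mk x)
  have hav : average ρ c' = ((Fintype.card F : K)⁻¹ • ∑ x : F, ρ (x, 1)) ∘ₗ R := by
    rw [average, map_smul, map_sum, LinearMap.smul_comp]
    congr 1
    refine Eq.trans ?_ (map_sum (LinearMap.lcomp K W R) (fun x : F => ρ (x, 1)) Finset.univ).symm
    refine Finset.sum_congr rfl fun x _ => ?_
    rw [Finsupp.linearCombination_mapDomain]
    have h1 := map_average (ρ.comp (MonoidHom.inr F G)) c (LinearMap.llcomp K W W W (ρ (x, 1)))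
    refine Eq.trans ?_ h1.symm
    congr 2
    funext g
    have : (x, g) = (x, 1) * ((1, g) : F × G) := by simp
    rw [Function.comp_apply, this, map_mul]
    rfl
  refine ⟨c', ⟨?_, ?_⟩, hav⟩
  · rw [map_smul, map_sum]
    simp only [Finsupp.linearCombination_mapDomain]
    have h1 : ∀ x : F, Finsupp.linearCombination K
        ((fun _ : F × G => (1 : K)) ∘ Prod.mk x) c = 1 := fun _ => h.sum_eq_one
    simp [h1, hF]
  · rintro ⟨y, g⟩
    rw [hav]
    refine LinearMap.ext fun w => ?_
    have hg : ρ (1, g) (R w) = R w := congrArg (fun f => f w) (h.comp_average g)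
    simp only [LinearMap.comp_apply, LinearMap.smul_apply, LinearMap.sum_apply, map_smul, map_sum]
    congr 1
    rw [← Equiv.sum_comp (Equiv.mulLeft y) fun x => ρ (x, 1) (R w)]
    refine Finset.sum_congr rfl fun x _ => ?_
    rw [← Module.End.mul_apply, ← map_mul]
    have : ((y, g) * (x, 1) : F × G) = (y * x, 1) * (1, g) := by simp
    rw [this, map_mul, Module.End.mul_apply, hg]
    rfl

end reynolds

/-- Reductive groups have Reynolds operators. -/
theorem IsReductive.exists_isReynolds {G : Type v} [Group G] [AffineAlgebraicGroup K G]
    (hG : IsReductive K G) {B : Type u} [AddCommGroup B] [Module K B] [FiniteDimensional K B]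
    {ρ : Representation K G B} (hρ : IsRational ρ) : ∃ c : G →₀ K, IsReynolds ρ c := by
  -- `G` acts by left multiplication on End B and trivially on K. In the span of the vectors (ρ g,
  -- 1), the second coordinate records the sum of the coefficients.
  let τ : Representation K G ((B →ₗ[K] B) × K) :=
    { toFun := fun g => LinearMap.prodMap (LinearMap.llcomp K B B B (ρ g)) LinearMap.id
      map_one' := by
        refine LinearMap.ext fun x => ?_
        rw [map_one]
        rfl
      map_mul' := fun g h => by
        refine LinearMap.ext fun x => ?_
        rw [map_mul]
        rfl }
  have hτ : ∀ g x, τ g x = (ρ g ∘ₗ x.1, x.2) := fun g x => rfl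
  have hτr : IsRational τ := by
    refine IsRegularMap.isRational ?_
    exact ((hρ.isRegularMap.linear (LinearMap.llcomp K B B B)).prodMk
      (isRegularMap_const (LinearMap.id : K →ₗ[K] K))).linear
      (LinearMap.prodMapLinear K (B →ₗ[K] B) K (B →ₗ[K] B) K K)
  have hss := hG _ τ hτr
  let A : Subrepresentation τ :=
    { toSubmodule := Submodule.span K (Set.range fun g => ((ρ g, 1) : (B →ₗ[K] B) × K))
      apply_mem_toSubmodule := fun g x hx => by
        have h1 : Submodule.span K (Set.range fun g => ((ρ g, 1) : (B →ₗ[K] B) × K)) ≤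
            (Submodule.span K (Set.range fun g => ((ρ g, 1) : (B →ₗ[K] B) × K))).comap (τ g) := by
          rw [Submodule.span_le]
          rintro _ ⟨h, rfl⟩
          refine Submodule.subset_span ⟨g * h, ?_⟩
          exact Prod.ext (map_mul ρ g h) rfl
        exact h1 hx }
  -- The part of coefficient sum zero. Splitting (1, 1) along a complement of it yields a vector `j`
  -- of the span with second coordinate 1.
  let I : Subrepresentation τ :=
    { toSubmodule := A.toSubmodule ⊓ LinearMap.ker (LinearMap.snd K (B →ₗ[K] B) K)
      apply_mem_toSubmodule := fun g x hx => ⟨A.apply_mem_toSubmodule g hx.1, hx.2⟩ }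
  obtain ⟨J, hJ⟩ := exists_isCompl I
  have htop : I.toSubmodule ⊔ J.toSubmodule = ⊤ := by
    rw [← Subrepresentation.toSubmodule_sup, codisjoint_iff.1 hJ.codisjoint]
    rfl
  have hbot : I.toSubmodule ⊓ J.toSubmodule = ⊥ := by
    rw [← Subrepresentation.toSubmodule_inf, disjoint_iff.1 hJ.disjoint]
    rfl
  have h1A : ((1, 1) : (B →ₗ[K] B) × K) ∈ A.toSubmodule :=
    Submodule.subset_span ⟨1, by simp⟩
  obtain ⟨i, hi, j, hj, hij⟩ := Submodule.mem_sup.1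
    (htop ▸ Submodule.mem_top : ((1, 1) : (B →ₗ[K] B) × K) ∈ I.toSubmodule ⊔ J.toSubmodule)
  have hjA : j ∈ A.toSubmodule := by
    rw [eq_sub_of_add_eq' hij]
    exact sub_mem h1A hi.1
  have hj2 : j.2 = 1 := by
    have h2 : i.2 = 0 := hi.2
    have := congrArg Prod.snd hij
    simpa [h2] using this
  -- The difference τ g j - j lies in the complement, and also in `I`, since `G` leaves the second
  -- coordinate unchanged.
  have hfix : ∀ g, τ g j = j := by
    intro g
    rw [← sub_eq_zero, ← Submodule.mem_bot K, ← hbot]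
    refine ⟨⟨sub_mem (A.apply_mem_toSubmodule g hjA) hjA, ?_⟩,
      sub_mem (J.apply_mem_toSubmodule g hj) hj⟩
    change (τ g j).2 - j.2 = 0
    rw [hτ, sub_self]
  obtain ⟨c, hc⟩ := Finsupp.mem_span_range_iff_exists_finsupp.1 hjA
  rw [← Finsupp.linearCombination_apply] at hc
  have hc1 : average ρ c = j.1 := by
    rw [← hc]
    exact (Finsupp.apply_linearCombination K (LinearMap.fst K (B →ₗ[K] B) K)
      (fun g => (ρ g, (1 : K))) c).symm
  refine ⟨c, ?_, fun g => ?_⟩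
  · refine Eq.trans ?_ ((congrArg Prod.snd hc).trans hj2)
    exact (Finsupp.apply_linearCombination K (LinearMap.snd K (B →ₗ[K] B) K)
      (fun g => (ρ g, (1 : K))) c).symm
  · rw [hc1]
    exact congrArg Prod.fst (hfix g)

/-! ### Tensor powers -/

open scoped TensorProduct

section tensor

variable {G : Type v} [Group G] {V : Type*} [AddCommGroup V] [Module K V]

theorem permRep_tprod {n : ℕ} (π : Equiv.Perm (Fin n)) (x : Fin n → V) :
    permRep K V n π (PiTensorProduct.tprod K x) =
      PiTensorProduct.tprod K fun j => x (π.symm j) :=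
  PiTensorProduct.reindex_tprod π x

theorem tensorRep_tprod (ρ : Representation K G V) {n : ℕ} (g : G) (x : Fin n → V) :
    tensorRep ρ n g (PiTensorProduct.tprod K x) = PiTensorProduct.tprod K fun j => ρ g (x j) :=
  PiTensorProduct.map_tprod _ _

/-- The trace of a permutation of the factors composed with the tensor power of an
endomorphism. -/
theorem trace_permRep_comp_map [FiniteDimensional K V] {n : ℕ} (π : Equiv.Perm (Fin n))
    (A : V →ₗ[K] V) :
    LinearMap.trace K _ (permRep K V n π ∘ₗ PiTensorProduct.map fun _ => A) =
      traceEval A (cycleMonomial K π) := by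
  classical
  let b := Module.Free.chooseBasis K V
  rw [traceEval_cycleMonomial b, cycleSum,
    LinearMap.trace_eq_matrix_trace K (Basis.piTensorProduct fun _ : Fin n => b), Matrix.trace]
  refine Finset.sum_congr rfl fun i _ => ?_
  -- In the basis of pure tensors the diagonal entry is a product of matrix entries; reindexing by π
  -- gives the summand of `cycleSum`.
  rw [Matrix.diag_apply, LinearMap.toMatrix_apply, Basis.piTensorProduct_apply,
    LinearMap.comp_apply, PiTensorProduct.map_tprod, permRep_tprod,
    Basis.piTensorProduct_repr_tprod_apply, ← Equiv.prod_comp π]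
  simp [LinearMap.toMatrix_apply]

/-- The action of the product of the symmetric group and of `G` on `V^{⊗ n}`. -/
def jointRep (ρ : Representation K G V) (n : ℕ) :
    Representation K (Equiv.Perm (Fin n) × G) (⨂[K] _ : Fin n, V) :=
  MonoidHom.noncommCoprod (permRep K V n) (tensorRep ρ n) fun π g =>
    LinearMap.ext fun x => (PiTensorProduct.map_reindex (R := K) (fun _ : Fin n => ρ g) π x).symm

theorem jointRep_apply (ρ : Representation K G V) {n : ℕ} (x : Equiv.Perm (Fin n) × G) :
    jointRep ρ n x = permRep K V n x.1 * tensorRep ρ n x.2 := rfl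

theorem jointRep_tprod (ρ : Representation K G V) {n : ℕ} (π : Equiv.Perm (Fin n)) (g : G)
    (x : Fin n → V) : jointRep ρ n (π, g) (PiTensorProduct.tprod K x) =
      PiTensorProduct.tprod K fun j => ρ g (x (π.symm j)) := by
  rw [jointRep_apply, Module.End.mul_apply, tensorRep_tprod, permRep_tprod]

theorem jointRep_comp_inr (ρ : Representation K G V) (n : ℕ) :
    (jointRep ρ n).comp (MonoidHom.inr (Equiv.Perm (Fin n)) G) = tensorRep ρ n := by
  refine MonoidHom.ext fun g => ?_
  rw [MonoidHom.comp_apply, MonoidHom.inr_apply, jointRep_apply, map_one, one_mul]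

/-- Invariant polynomials are the invariant symmetric multilinear forms. -/
def invariantPolynomialsEquiv [CharZero K] (ρ : Representation K G V) (r : ℕ) :
    (jointRep ρ r).dual.invariants ≃ₗ[K] invariantPolynomials ρ r := by
  have hinv : ∀ (ℓ : (jointRep ρ r).dual.invariants) (π : Equiv.Perm (Fin r)) (g : G)
      (x : Fin r → V), ℓ.1 (PiTensorProduct.tprod K fun j => ρ g (x (π j))) =
        ℓ.1 (PiTensorProduct.tprod K x) := by
    intro ℓ π g x
    have h := congrArg (fun f => f (PiTensorProduct.tprod K x)) (ℓ.2 (π, g⁻¹))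
    simp only [Representation.dual_apply, Module.Dual.transpose_apply, LinearMap.comp_apply,
      Prod.inv_mk, inv_inv, jointRep_tprod] at h
    exact h
  let F : (jointRep ρ r).dual.invariants →ₗ[K] invariantPolynomials ρ r :=
    { toFun := fun ℓ => ⟨fun w => ℓ.1 (PiTensorProduct.tprod K fun _ => w),
        ⟨ℓ.1.compMultilinearMap (PiTensorProduct.tprod K), fun x => rfl⟩,
        fun g w => hinv ℓ 1 g fun _ => w⟩
      map_add' := fun ℓ ℓ' => rfl
      map_smul' := fun c ℓ => rfl }
  refine LinearEquiv.ofBijective F ⟨?_, ?_⟩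
  · intro ℓ ℓ' h
    refine Subtype.ext (PiTensorProduct.ext ?_)
    have hsymm : ∀ (ℓ : (jointRep ρ r).dual.invariants) (σ : Equiv.Perm (Fin r)) (x : Fin r → V),
        (ℓ.1.compMultilinearMap (PiTensorProduct.tprod K)) (fun i => x (σ i)) =
          (ℓ.1.compMultilinearMap (PiTensorProduct.tprod K)) x := by
      intro ℓ σ x
      have := hinv ℓ σ 1 x
      simpa using this
    exact multilinearMap_ext_diagonal (hsymm ℓ) (hsymm ℓ') fun x =>
      congrFun (congrArg Subtype.val h) x
  · rintro ⟨f, ⟨φ, hφ⟩, hf⟩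
    -- The form φ itself need not be invariant, but its symmetrization is determined by the
    -- invariant function `f`.
    have hg : ∀ g, (symmetrize φ).compLinearMap (fun _ => ρ g) = symmetrize φ := by
      intro g
      refine multilinearMap_ext_diagonal (fun σ x => ?_) (fun σ x => symmetrize_perm φ σ x)
        fun x => ?_
      · exact symmetrize_perm φ σ fun i => ρ g (x i)
      · rw [MultilinearMap.compLinearMap_apply, symmetrize_diagonal, symmetrize_diagonal, ← hφ,
          ← hφ, hf]
    refine ⟨⟨PiTensorProduct.lift (symmetrize φ), ?_⟩, ?_⟩
    · rintro ⟨π, g⟩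
      rw [Representation.dual_apply, Module.Dual.transpose_apply]
      refine PiTensorProduct.ext (MultilinearMap.ext fun x => ?_)
      simp only [LinearMap.compMultilinearMap_apply, LinearMap.comp_apply, Prod.inv_mk,
        jointRep_tprod, PiTensorProduct.lift.tprod]
      rw [← symmetrize_perm φ π⁻¹.symm x]
      exact congrArg (fun ψ => ψ fun i => x (π⁻¹.symm i)) (hg g⁻¹)
    · refine Subtype.ext (funext fun w => ?_)
      change PiTensorProduct.lift (symmetrize φ) (PiTensorProduct.tprod K fun _ => w) = f w
      rw [PiTensorProduct.lift.tprod, symmetrize_diagonal, hφ]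

/-- The linear form on polynomials in the power sums given by an element of the group algebra. -/
def averageTraceEval (ρ : Representation K G V) (c : G →₀ K) : MvPolynomial ℕ+ K →ₗ[K] K :=
  Finsupp.linearCombination K (fun g => (traceEval (ρ g)).toLinearMap) c

theorem averageTraceEval_apply (ρ : Representation K G V) (c : G →₀ K) (q : MvPolynomial ℕ+ K) :
    averageTraceEval ρ c q = Finsupp.linearCombination K (fun g => traceEval (ρ g) q) c :=
  Finsupp.apply_linearCombination K (LinearMap.applyₗ q) _ c

theorem trace_permRep_comp_average [FiniteDimensional K V] (ρ : Representation K G V)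
    (c : G →₀ K) {n : ℕ} (π : Equiv.Perm (Fin n)) :
    LinearMap.trace K _ (permRep K V n π ∘ₗ average (tensorRep ρ n) c) =
      averageTraceEval ρ c (cycleMonomial K π) := by
  have h := map_average (tensorRep ρ n) c
    (LinearMap.trace K _ ∘ₗ LinearMap.llcomp K _ _ _ (permRep K V n π))
  rw [averageTraceEval_apply]
  simp only [← trace_permRep_comp_map]
  exact h

/-- The trace on the invariants is that of π composed with the Reynolds projection, which expands
over the group elements in `c`. -/
theorem trace_tensorInvariants [FiniteDimensional K V] (ρ : Representation K G V)
    {c : G →₀ K} {n : ℕ} (h : IsReynolds (tensorRep ρ n) c) (π : Equiv.Perm (Fin n)) :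
    LinearMap.trace K _ ((tensorInvariants ρ n).toRepresentation π) =
      averageTraceEval ρ c (cycleMonomial K π) := by
  rw [← trace_permRep_comp_average]
  exact trace_restrict_of_isProj h.isProj _ _ fun x => rfl

/-- The dimension of the space of invariant polynomials, as an average of traces. -/
theorem finrank_invariantPolynomials [CharZero K] [FiniteDimensional K V]
    (ρ : Representation K G V) {r : ℕ} {c c' : G →₀ K} (h : IsReynolds (tensorRep ρ r) c)
    (h' : IsReynolds (tensorRep ρ r).dual c') :
    (Module.finrank K (invariantPolynomials ρ r) : K) = (r.factorial : K)⁻¹ *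
      ∑ τ : Equiv.Perm (Fin r), averageTraceEval ρ c (cycleMonomial K τ) := by
  have h₁ : IsReynolds ((jointRep ρ r).comp (MonoidHom.inr (Equiv.Perm (Fin r)) G)) c := by
    rwa [jointRep_comp_inr]
  have h₁' : IsReynolds ((jointRep ρ r).dual.comp (MonoidHom.inr (Equiv.Perm (Fin r)) G)) c' := by
    have : (jointRep ρ r).dual.comp (MonoidHom.inr (Equiv.Perm (Fin r)) G) =
        (tensorRep ρ r).dual := by
      rw [← jointRep_comp_inr]
      refine MonoidHom.ext fun g => ?_
      rw [MonoidHom.comp_apply, Representation.dual_apply, Representation.dual_apply,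
        MonoidHom.comp_apply, ← map_inv]
    rwa [this]
  -- Averaging over S_r as well extends both elements to S_r × G. The one for the dual serves only
  -- to equate the dimensions of the two spaces of invariants, so it may come from an unrelated
  -- `c'`.
  obtain ⟨d, hd, hav⟩ := h₁.exists_prod_finite
  obtain ⟨d', hd', -⟩ := h₁'.exists_prod_finite
  rw [← (invariantPolynomialsEquiv ρ r).finrank_eq, finrank_invariants_dual hd hd',
    hd.finrank_invariants, hav, jointRep_comp_inr, LinearMap.smul_comp, map_smul, smul_eq_mul,
    Fintype.card_perm, Fintype.card_fin]
  congr 1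
  have hsum := map_sum (LinearMap.trace K _ ∘ₗ LinearMap.lcomp K _ (average (tensorRep ρ r) c))
    (fun τ : Equiv.Perm (Fin r) => jointRep ρ r (τ, 1)) Finset.univ
  refine hsum.trans (Finset.sum_congr rfl fun τ _ => ?_)
  rw [← trace_permRep_comp_average, jointRep_apply, map_one, mul_one]
  rfl

theorem isRational_tensorRep [AffineAlgebraicGroup K G] [FiniteDimensional K V]
    {ρ : Representation K G V} (h : IsRational ρ) (n : ℕ) : IsRational (tensorRep ρ n) :=
  IsRegularMap.isRational
    (h.isRegularMap.multilinear (PiTensorProduct.mapMultilinear K (fun _ => V) fun _ => V))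

theorem IsRational.dual [AffineAlgebraicGroup K G] [FiniteDimensional K V]
    {ρ : Representation K G V} (h : IsRational ρ) : IsRational ρ.dual := by
  have h1 : IsRegularMap (K := K) fun g => Module.Dual.transpose (R := K) (ρ g⁻¹) :=
    h.isRegularMap.inv.linear _
  exact IsRegularMap.isRational (ρ := ρ.dual) h1

theorem IsRational.prod [AffineAlgebraicGroup K G] [FiniteDimensional K V] {W : Type*}
    [AddCommGroup W] [Module K W] [FiniteDimensional K W] {ρ : Representation K G V}
    {ρ' : Representation K G W} (h : IsRational ρ) (h' : IsRational ρ') :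
    IsRational (ρ.prod ρ') :=
  IsRegularMap.isRational ((h.isRegularMap.prodMk h'.isRegularMap).linear
    (LinearMap.prodMapLinear K V W V W K))

end tensor

/-- P(ρ g) depends polynomially on ρ g, so its matrix coefficients remain regular. -/
theorem isRational_functorRep {G : Type v} [Group G] [AffineAlgebraicGroup K G] {V : Type u}
    [AddCommGroup V] [Module K V] [FiniteDimensional K V] {ρ : Representation K G V}
    (h : IsRational ρ) {k : ℕ} {P : FGModuleCat.{u} K ⥤ FGModuleCat.{u} K}
    (hP : IsHomogeneousPolynomialFunctor k P) : IsRational (functorRep P ρ) := by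
  obtain ⟨φ, hφ⟩ := hP V V
  refine IsRegularMap.isRational ?_
  have h1 : (fun g => functorRep P ρ g) = fun g => φ fun _ => ρ g := funext fun g => hφ (ρ g)
  rw [h1]
  exact h.isRegularMap.multilinear φ

theorem finite_invariantPolynomials [CharZero K] {G : Type v} [Group G] {V : Type*}
    [AddCommGroup V] [Module K V] [FiniteDimensional K V] (ρ : Representation K G V) (r : ℕ) :
    Module.Finite K (invariantPolynomials ρ r) :=
  Module.Finite.equiv (invariantPolynomialsEquiv ρ r)

theorem finrank_invariantPolynomials_functorRep [CharZero K] {G : Type v} [Group G]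
    [AffineAlgebraicGroup K G] (hG : IsReductive K G) {V : Type u} [AddCommGroup V] [Module K V]
    [FiniteDimensional K V] {ρ : Representation K G V} (hρ : IsRational ρ) {k : ℕ}
    {P : FGModuleCat.{u} K ⥤ FGModuleCat.{u} K} (hP : IsHomogeneousPolynomialFunctor k P) (r : ℕ) :
    (Module.finrank K (invariantPolynomials (functorRep P ρ) r) : K) =
      hallInner (plethysm (completeHomogeneous K r) (character P))
        (tensorInvariantCharacter ρ (r * k)) := by
  have hT := isRational_tensorRep (isRational_functorRep hρ hP) r
  -- A common `c` for V^{⊗rk} and P(V)^{⊗r}: both sides of the identity become averages with the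
  -- same coefficients and can be compared for each g.
  obtain ⟨c, hc⟩ := hG.exists_isReynolds ((isRational_tensorRep hρ (r * k)).prod hT)
  obtain ⟨c', hc'⟩ := hG.exists_isReynolds hT.dual
  obtain ⟨hcV, hcT⟩ := hc.of_prod
  rw [finrank_invariantPolynomials _ hcT hc', tensorInvariantCharacter, frobeniusCharacter,
    plethysm_completeHomogeneous_character hP]
  simp only [trace_tensorInvariants ρ hcV]
  rw [hallInner_aeval _ (isHomogeneousOfWeight_plethysmExpansion hP r), averageTraceEval_apply]
  simp only [traceEval_plethysmExpansion, averageTraceEval_apply,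
    Finsupp.linearCombination_apply, Finsupp.sum, smul_eq_mul, Finset.mul_sum]
  rw [Finset.sum_comm]
  refine Finset.sum_congr rfl fun g _ => Finset.sum_congr rfl fun τ _ => ?_
  rw [mul_left_comm]
  rfl

end TensorInvariants

end

open TensorInvariants in
theorem mainTheorem3 {K : Type u} [Field K] [CharZero K]
    {G : Type v} [Group G] [AffineAlgebraicGroup K G] (hG : IsReductive K G)
    {V : Type u} [AddCommGroup V] [Module K V] [FiniteDimensional K V]
    (ρ : Representation K G V) (hρ : IsRational ρ)
    (k : ℕ) (P : CategoryTheory.Functor (FGModuleCat.{u} K) (FGModuleCat.{u} K))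
    (hP : IsHomogeneousPolynomialFunctor k P) :
    (∃! F : SymFun K, IsCharacter P F) ∧
    (∀ r : ℕ, Module.Finite K (invariantPolynomials (functorRep P ρ) r) ∧
      (Module.finrank K (invariantPolynomials (functorRep P ρ) r) : K) =
        hallInner (plethysm (completeHomogeneous K r) (character P))
          (tensorInvariantCharacter ρ (r * k))) ∧
    (hilbertSeries (functorRep P ρ)).map (Nat.castRingHom K) =
      PowerSeries.mk fun r => hallInner (plethysm (completeHomogeneous K r) (character P))
        (tensorInvariantCharacter ρ (r * k)) := by
  refine ⟨⟨_, isCharacter_characterExpansion hP,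
    fun F hF => hF.unique (isCharacter_characterExpansion hP)⟩, fun r =>
    ⟨finite_invariantPolynomials _ r, finrank_invariantPolynomials_functorRep hG hρ hP r⟩, ?_⟩
  ext r
  rw [PowerSeries.coeff_map, hilbertSeries, PowerSeries.coeff_mk, PowerSeries.coeff_mk]
  exact finrank_invariantPolynomials_functorRep hG hρ hP r
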